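/- Let $N\ge 2$ be an integer, $\mu>0$ and $\beta>0$. Let $\Omega_N=\bigoplus_{i\ge1}\mathbb Z_N$ be the hierarchical group of order $N$ with the distance $|x-y|$, where $|0|=0$ and $|x|=\max\{i: x_i\ne 0\}$ for $x\ne0$. The continuous-time $(\mu,((j+1)^\beta),N)$-random walk $X$ on $\Omega_N$ has unit-rate exponential holding times and i.i.d. jumps $\eta$ with $$\mathbb P[\eta=y]=\frac{r_{|y|}}{N^{|y|-1}(N-1)}\quad(y\ne 0),\qquad \mathbb P[\eta=0]=0,\qquad r_j=D\,\frac{j^{\beta}}{N^{(j-1)/\mu}}\quad (j=1,2,\dots),$$ where $D$ is the normalizing constant for which $\sum_{j\ge 1}r_j=1$. Let $p_t(x,y)$ be its transition probabilities, $T_t\varphi(x)=\sum_y p_t(x,y)\varphi(y)$ its semigroup, and for $\zeta>0$ and bounded $\varphi\ge 0$ with bounded support put $$G^{\zeta}\varphi=\frac1{\Gamma(\zeta)}\int_0^\infty t^{\zeta-1}T_t\varphi\,dt\in[0,\infty],\qquad g^{(\zeta)}_t=\frac1{\Gamma(\zeta)}\int_0^t s^{\zeta-1}p_s(0,0)\,ds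 .$$ The degree of $X$ is $\gamma=\sup\{\zeta>-1:\ G^{\zeta+1}\varphi<\infty \text{ for all bounded } \varphi\ge0 \text{ with bounded support}\}$, and $X$ is said to have degree $\gamma^-$ if it has finite degree $\gamma$ and $G^{\gamma+1}\varphi\equiv\infty$ for every bounded $\varphi\ge 0$ with bounded support, $\varphi\neq0$. Then: 1. $X$ has degree $\gamma=\mu-1$. 2. $X$ has degree $(\mu-1)^-$ if and only if $\beta\le 1/\mu$. 3. If $\beta=1/\mu$, there is a constant $C>0$ (depending only on $\mu,N$) such that $g^{(\mu)}_t\sim C\log\log t$ as $t\to\infty$. 4. If $0<\beta<1/\mu$, there is a constant $C>0$ (depending only on $\mu,\beta,N$) such that $g^{(\mu)}_t\sim C(\log t)^{1-\beta\mu}$ as $t\to\infty$. -/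

import Mathlib

open scoped ENNReal NNReal
open MeasureTheory Filter Asymptotics

noncomputable section

/-! ### Green operator powers and the degree of a random walk

A continuous-time random walk on a countable discrete metric Abelian group `S` is given through the
laws `P t` of its position `X(t)` when it starts from the origin, so that started from `x` it is at
time `t` at `x + X(t)`. All functions on the discrete space `S` are measurable. -/

section Degree

/-- The transition semigroup `T_t φ (x) = 𝔼_x φ(X(t))`, on non-negative functions. -/
def transitionSemigroup {S : Type*} [AddCommGroup S] (P : ℝ → PMF S) (t : ℝ) (φ : S → ℝ≥0)
    (x : S) : ℝ≥0∞ :=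
  ∑' y : S, P t y * (φ (x + y) : ℝ≥0∞)

/-- The fractional power of the Green operator,
`G^ζ φ = (1 / Γ(ζ)) ∫_0^∞ t^(ζ-1) T_t φ dt`, with values in `[0, ∞]`. -/
def greenPower {S : Type*} [AddCommGroup S] (P : ℝ → PMF S) (ζ : ℝ) (φ : S → ℝ≥0)
    (x : S) : ℝ≥0∞ :=
  (∫⁻ t in Set.Ioi (0 : ℝ), ENNReal.ofReal (t ^ (ζ - 1)) * transitionSemigroup P t φ x) /
    ENNReal.ofReal (Real.Gamma ζ)

/-- The class of non-negative bounded functions with bounded support. -/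
def BddSupp (S : Type*) [PseudoMetricSpace S] : Set (S → ℝ≥0) :=
  {φ | (∃ M : ℝ≥0, ∀ x, φ x ≤ M) ∧ Bornology.IsBounded (Function.support φ)}

/-- `G^ζ` is finite. -/
def GreenPowerFinite {S : Type*} [AddCommGroup S] [PseudoMetricSpace S] (P : ℝ → PMF S)
    (ζ : ℝ) : Prop :=
  ∀ φ ∈ BddSupp S, ∀ x, greenPower P ζ φ x < ∞

/-- The degree: the supremum (in `[-∞, ∞]`) of all `ζ > -1` such that `G^(ζ+1)` is finite. -/
def degree {S : Type*} [AddCommGroup S] [PseudoMetricSpace S] (P : ℝ → PMF S) : EReal :=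
  sSup {z : EReal | ∃ ζ : ℝ, -1 < ζ ∧ GreenPowerFinite P (ζ + 1) ∧ z = (ζ : EReal)}

/-- The walk has degree `γ⁻`: it has degree `γ`, and `G^(γ+1) φ ≡ ∞` for all `φ ≠ 0`. -/
def HasDegreeMinus {S : Type*} [AddCommGroup S] [PseudoMetricSpace S] (P : ℝ → PMF S)
    (γ : ℝ) : Prop :=
  degree P = (γ : EReal) ∧ ∀ φ ∈ BddSupp S, φ ≠ 0 → ∀ x, greenPower P (γ + 1) φ x = ∞

/-- The incomplete potential `g_t^(ζ) = (1 / Γ(ζ)) ∫_0^t s^(ζ-1) p_s(0,0) ds`, where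
`p_s(0,0) = P s 0`. -/
def incompletePotential {S : Type*} [AddCommGroup S] (P : ℝ → PMF S) (ζ t : ℝ) : ℝ :=
  (1 / Real.Gamma ζ) * ∫ s in (0 : ℝ)..t, s ^ (ζ - 1) * (P s 0).toReal

end Degree

/-! ### The hierarchical group -/

section HierarchicalGroup

/-- The hierarchical group of order `N`: the direct sum of countably many copies of the cyclic group
`ℤ_N`. The coordinate called `x_{i+1}` in mathematical notation is `x i` here (`i = 0, 1, …`). -/
abbrev HierarchicalGroup (N : ℕ) : Type := ℕ →₀ ZMod N

/-- `|x| = max {i ≥ 1 : x_i ≠ 0}`, and `|0| = 0`. -/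
def hierNorm {N : ℕ} (x : HierarchicalGroup N) : ℕ :=
  x.support.sup (· + 1)

theorem hierNorm_le_iff {N : ℕ} (x : HierarchicalGroup N) (k : ℕ) :
    hierNorm x ≤ k ↔ ∀ i, k ≤ i → x i = 0 := by
  unfold hierNorm
  rw [Finset.sup_le_iff]
  constructor
  · intro h i hi
    by_contra hne
    have := h i (Finsupp.mem_support_iff.2 hne)
    omega
  · intro h i hi
    by_contra hlt
    exact (Finsupp.mem_support_iff.1 hi) (h i (by omega))

theorem hierNorm_zero {N : ℕ} : hierNorm (0 : HierarchicalGroup N) = 0 :=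
  Nat.le_zero.1 ((hierNorm_le_iff _ _).2 fun _ _ => rfl)

theorem hierNorm_eq_zero {N : ℕ} (x : HierarchicalGroup N) : hierNorm x = 0 ↔ x = 0 := by
  constructor
  · intro h
    have := (hierNorm_le_iff x 0).1 h.le
    exact Finsupp.ext fun i => this i (Nat.zero_le _)
  · rintro rfl
    exact hierNorm_zero

theorem hierNorm_neg {N : ℕ} (x : HierarchicalGroup N) : hierNorm (-x) = hierNorm x :=
  congrArg (fun s : Finset ℕ => s.sup (· + 1)) (Finsupp.support_neg x)

theorem hierNorm_add_le {N : ℕ} (x y : HierarchicalGroup N) :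
    hierNorm (x + y) ≤ max (hierNorm x) (hierNorm y) := by
  rw [hierNorm_le_iff]
  intro i hi
  have hx := (hierNorm_le_iff x _).1 ((le_max_left _ _).trans hi) i le_rfl
  have hy := (hierNorm_le_iff y _).1 ((le_max_right _ _).trans hi) i le_rfl
  exact (congrArg₂ (· + ·) hx hy).trans (add_zero _)

/-- The hierarchical distance `|x - y|`. -/
instance (N : ℕ) : MetricSpace (HierarchicalGroup N) where
  dist x y := (hierNorm (x - y) : ℝ)
  dist_self x := by simp [hierNorm_zero]
  dist_comm x y := by
    show (hierNorm (x - y) : ℝ) = hierNorm (y - x)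
    rw [← hierNorm_neg, neg_sub]
  dist_triangle x y z := by
    show (hierNorm (x - z) : ℝ) ≤ hierNorm (x - y) + hierNorm (y - z)
    have h := hierNorm_add_le (x - y) (y - z)
    rw [sub_add_sub_cancel] at h
    exact_mod_cast h.trans (by omega)
  eq_of_dist_eq_zero {x y} h := by
    have h' : (hierNorm (x - y) : ℝ) = 0 := h
    exact sub_eq_zero.1 ((hierNorm_eq_zero _).1 (by exact_mod_cast h'))

/-- The ball `{x : |x| ≤ k}` is in bijection with `ℤ_N^k`. -/
def hierBallEquiv (N k : ℕ) : {x : HierarchicalGroup N // hierNorm x ≤ k} ≃ (Fin k → ZMod N) where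
  toFun x i := x.1 i
  invFun f := ⟨Finsupp.onFinset (Finset.range k) (fun i => if h : i < k then f ⟨i, h⟩ else 0)
      (by
        intro i hi
        by_contra hn
        rw [Finset.mem_range] at hn
        simp [hn] at hi), by
    rw [hierNorm_le_iff]
    intro i hi
    simp [hi]⟩
  left_inv x := by
    apply Subtype.ext
    refine Finsupp.ext fun i => ?_
    by_cases h : i < k
    · simp [h]
    · simpa [h] using ((hierNorm_le_iff x.1 k).1 x.2 i (by omega)).symm
  right_inv f := by
    funext i
    simp

theorem hierBall_ncard (N : ℕ) [NeZero N] (k : ℕ) :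
    {x : HierarchicalGroup N | hierNorm x ≤ k}.ncard = N ^ k := by
  rw [← Nat.card_coe_set_eq]
  refine (Nat.card_congr (hierBallEquiv N k)).trans ?_
  simp

theorem hierBall_finite (N : ℕ) [NeZero N] (k : ℕ) :
    {x : HierarchicalGroup N | hierNorm x ≤ k}.Finite :=
  @Set.toFinite _ _ (Finite.of_equiv _ (hierBallEquiv N k).symm)

/-- There are `N^j (N-1)` points at distance `j + 1` from the origin. -/
theorem hierSphere_ncard (N : ℕ) [NeZero N] (j : ℕ) :
    {x : HierarchicalGroup N | hierNorm x = j + 1}.ncard = N ^ j * (N - 1) := by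
  have h : {x : HierarchicalGroup N | hierNorm x = j + 1} =
      {x | hierNorm x ≤ j + 1} \ {x | hierNorm x ≤ j} := by
    ext x
    simp only [Set.mem_ofPred_eq, Set.mem_sdiff]
    omega
  have hsub : {x : HierarchicalGroup N | hierNorm x ≤ j} ⊆ {x | hierNorm x ≤ j + 1} := by
    intro x hx
    simp only [Set.mem_ofPred_eq] at hx ⊢
    omega
  rw [h, Set.ncard_sdiff hsub (hierBall_finite N j), hierBall_ncard, hierBall_ncard,
    Nat.mul_sub_one, pow_succ]

end HierarchicalGroup

/-! ### Hierarchical random walks -/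

section Walk

/-- The weight of one step of the `r_j`-random walk: `r_{|y|} / (N^(|y|-1) (N-1))` for `y ≠ 0`, and
`0` for `y = 0`. The probability `r_{j+1}` of jumping distance `j + 1` is `r j` here. -/
def stepWeight (N : ℕ) (r : PMF ℕ) (y : HierarchicalGroup N) : ℝ≥0∞ :=
  if y = 0 then 0
  else r (hierNorm y - 1) / ((N : ℝ≥0∞) ^ (hierNorm y - 1) * ((N - 1 : ℕ) : ℝ≥0∞))

theorem stepWeight_hasSum {N : ℕ} (hN : 2 ≤ N) (r : PMF ℕ) : HasSum (stepWeight N r) 1 := by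
  have : NeZero N := ⟨by omega⟩
  rw [ENNReal.summable.hasSum_iff,
    ← (Equiv.sigmaFiberEquiv (hierNorm (N := N))).tsum_eq (stepWeight N r)]
  refine (ENNReal.tsum_sigma (fun (j : ℕ) (x : {x : HierarchicalGroup N // hierNorm x = j}) =>
    stepWeight N r x)).trans ?_
  have key : ∀ j : ℕ, ∑' x : {x : HierarchicalGroup N // hierNorm x = j + 1},
      stepWeight N r x = r j := by
    intro j
    have hx : ∀ x : {x : HierarchicalGroup N // hierNorm x = j + 1},
        stepWeight N r x = r j / ((N : ℝ≥0∞) ^ j * ((N - 1 : ℕ) : ℝ≥0∞)) := by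
      rintro ⟨x, hx⟩
      have h0 : x ≠ 0 := by
        rintro rfl
        rw [hierNorm_zero] at hx
        omega
      simp [stepWeight, h0, hx]
    have : Finite {x : HierarchicalGroup N // hierNorm x = j + 1} :=
      ((hierBall_finite N (j + 1)).subset fun x hx => le_of_eq hx)
    rw [tsum_congr hx, ENNReal.tsum_const, ENat.card_eq_coe_natCard]
    have hc : Nat.card {x : HierarchicalGroup N // hierNorm x = j + 1} = N ^ j * (N - 1) :=
      (Nat.card_coe_set_eq _).trans (hierSphere_ncard N j)
    rw [hc]
    have h1 : ((N : ℝ≥0∞) ^ j * ((N - 1 : ℕ) : ℝ≥0∞)) ≠ 0 := by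
      refine mul_ne_zero (pow_ne_zero _ ?_) ?_
      · exact_mod_cast (by omega : N ≠ 0)
      · exact_mod_cast (by omega : N - 1 ≠ 0)
    have h2 : ((N : ℝ≥0∞) ^ j * ((N - 1 : ℕ) : ℝ≥0∞)) ≠ ∞ :=
      ENNReal.mul_ne_top (ENNReal.pow_ne_top (ENNReal.natCast_ne_top _)) (ENNReal.natCast_ne_top _)
    push_cast at h1 h2 ⊢
    exact ENNReal.mul_div_cancel h1 h2
  have h0 : ∑' x : {x : HierarchicalGroup N // hierNorm x = 0}, stepWeight N r x = 0 := by
    rw [ENNReal.tsum_eq_zero]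
    rintro ⟨x, hx⟩
    simp [stepWeight, (hierNorm_eq_zero x).1 hx]
  refine (tsum_eq_zero_add' ENNReal.summable).trans ?_
  exact (congrArg₂ (· + ·) h0 (tsum_congr key)).trans ((zero_add _).trans r.tsum_coe)

/-- The distribution of one step of the `r_j`-random walk on the hierarchical group. -/
def stepPMF {N : ℕ} (hN : 2 ≤ N) (r : PMF ℕ) : PMF (HierarchicalGroup N) :=
  ⟨stepWeight N r, stepWeight_hasSum hN r⟩

/-- The law of the discrete-time walk started from `0` after `n` independent steps with law `q`,
i.e. the `n`-fold convolution of `q`. -/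
def nStepPMF {S : Type*} [AddCommGroup S] (q : PMF S) : ℕ → PMF S
  | 0 => PMF.pure 0
  | n + 1 => (nStepPMF q n).bind fun x => q.map fun y => x + y

/-- The law at time `t ≥ 0` of the continuous-time walk with unit rate holding times: a
Poisson(`t`)-distributed number of independent steps, that is,
`p_t(0,y) = e^(-t) ∑ₙ (t^n / n!) p^(n)(0,y)`. (For `t < 0` the value is that for `t = 0`.) -/
def walkPMF {S : Type*} [AddCommGroup S] (q : PMF S) (t : ℝ) : PMF S :=
  (ProbabilityTheory.poissonMeasure t.toNNReal).toPMF.bind (nStepPMF q)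

/-- The weights `c_j / N^(j/μ)`, to which the probability of jumping distance `j + 1` is
proportional. -/
def radiusWeight (μ : ℝ) (c : ℕ → ℝ) (N : ℕ) (j : ℕ) : ℝ :=
  c j / (N : ℝ) ^ ((j : ℝ) / μ)

/-- The jump distances of the `(μ, (c_j), N)`-random walk: distance `j + 1` has probability
`r_{j+1} = D c_j / N^(j/μ)`, where `D` is the normalizing constant. -/
def radiusPMF (μ : ℝ) (c : ℕ → ℝ) (N : ℕ) (h0 : ∀ j, 0 < radiusWeight μ c N j)
    (h1 : Summable (radiusWeight μ c N)) : PMF ℕ :=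
  PMF.normalize (fun j => ENNReal.ofReal (radiusWeight μ c N j))
    (fun h => absurd (ENNReal.tsum_eq_zero.1 h 0) (by simpa using h0 0))
    h1.tsum_ofReal_ne_top

/-- The laws of the continuous-time `(μ, (c_j), N)`-random walk started from `0`. -/
def hierWalk {N : ℕ} (hN : 2 ≤ N) (μ : ℝ) (c : ℕ → ℝ) (h0 : ∀ j, 0 < radiusWeight μ c N j)
    (h1 : Summable (radiusWeight μ c N)) : ℝ → PMF (HierarchicalGroup N) :=
  walkPMF (stepPMF hN (radiusPMF μ c N h0 h1))

/-- The sequence `c_j = (j+1)^β`. -/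
def powSeq (β : ℝ) (j : ℕ) : ℝ := ((j : ℝ) + 1) ^ β

theorem radiusWeight_powSeq_pos {N : ℕ} (hN : 2 ≤ N) (μ β : ℝ) (j : ℕ) :
    0 < radiusWeight μ (powSeq β) N j := by
  have : (0 : ℝ) < N := by exact_mod_cast (by omega : 0 < N)
  unfold radiusWeight powSeq
  positivity

theorem radiusWeight_powSeq_summable {N : ℕ} (hN : 2 ≤ N) {μ : ℝ} (hμ : 0 < μ) (β : ℝ) :
    Summable (radiusWeight μ (powSeq β) N) := by
  have hN0 : (0 : ℝ) < N := by exact_mod_cast (by omega : 0 < N)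
  have hN1 : (1 : ℝ) < N := by exact_mod_cast (by omega : 1 < N)
  set ρ : ℝ := (N : ℝ) ^ (-(1 / μ)) with hρ
  have hρ0 : 0 < ρ := Real.rpow_pos_of_pos hN0 _
  have hρ1 : ρ < 1 := Real.rpow_lt_one_of_one_lt_of_neg hN1 (by simpa using hμ)
  have hs := (summable_nat_add_iff 1).2 (summable_pow_mul_geometric_of_norm_lt_one (R := ℝ) ⌈β⌉₊
    (r := ρ) (by rwa [Real.norm_of_nonneg hρ0.le]))
  refine Summable.of_nonneg_of_le (fun j => (radiusWeight_powSeq_pos hN μ β j).le) (fun j => ?_)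
    (hs.mul_right ρ⁻¹)
  have e : (N : ℝ) ^ ((j : ℝ) / μ) = (ρ ^ j)⁻¹ := by
    rw [hρ, ← Real.rpow_natCast, ← Real.rpow_mul hN0.le, ← Real.rpow_neg hN0.le]
    congr 1
    ring
  have hb : ((j : ℝ) + 1) ^ β ≤ ((j : ℝ) + 1) ^ ⌈β⌉₊ := by
    rw [← Real.rpow_natCast]
    exact Real.rpow_le_rpow_of_exponent_le (by linarith [j.cast_nonneg (α := ℝ)]) (Nat.le_ceil β)
  have hj : ρ ^ (j + 1) * ρ⁻¹ = ρ ^ j := by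
    rw [pow_succ, mul_assoc, mul_inv_cancel₀ hρ0.ne', mul_one]
  unfold radiusWeight powSeq
  rw [e, div_inv_eq_mul, mul_assoc, hj]
  push_cast
  exact mul_le_mul_of_nonneg_right hb (pow_nonneg hρ0.le j)

/-- The continuous-time `(μ, ((j+1)^β), N)`-random walk started from `0`. -/
def powWalk {N : ℕ} (hN : 2 ≤ N) {μ : ℝ} (hμ : 0 < μ) (β : ℝ) : ℝ → PMF (HierarchicalGroup N) :=
  hierWalk hN μ (powSeq β) (radiusWeight_powSeq_pos hN μ β) (radiusWeight_powSeq_summable hN hμ β)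

end Walk

end

open scoped ENNReal NNReal
open MeasureTheory Filter Asymptotics

noncomputable section

/-! ### Haar components of a law on the hierarchical group -/

section Haar

variable {N : ℕ}

/-! Balls of the hierarchical group are subgroups and the step law depends only on `hierNorm`, so
the Haar functions (normalised indicator of a ball minus that of the next larger ball) are
eigenfunctions of the walk. The eigenvalue is `1 - h_k`, where `h_k = haarRate N r k`. Their sum
over `k` telescopes to the point mass at `0`, and Poissonisation turns powers of the eigenvalue into
exponentials: `p_t(0,x) = ∑ₖ exp(-h_k t) haarFun N k x` (`hasSum_walkPMF`).

Integrating against `t^(ζ-1)` gives `Γ(ζ) ∑ₖ potCoeff ζ k` at `x = 0`. Since `h_k` is asymptotic to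
a constant times `(k+1)^β N^(-k/μ)`, the coefficient behaves like `(k+1)^(-βζ) N^(k(ζ/μ-1))`. The
series converges for `ζ < μ` and diverges for `ζ > μ`; at `ζ = μ` it is a p-series with exponent
`βμ`. General `φ` reduce to the origin because `p_t(0,x) ≤ p_t(0,0)` and the difference is a finite
sum of exponentials. This gives the degree statements.

For the incomplete potential, each critical coefficient is weighted by the normalised lower
incomplete Gamma function at `h_k t`. The cutoff `J = exploredLevel N μ t`, about `μ log t / log N`,
splits the sum: below `J` the weight is essentially 1, while the levels above contribute a bounded
amount. Hence `g_t` is asymptotic to a constant times `∑_{k<J} (k+1)^(-βμ)`, of order `log J` or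
`J^(1-βμ)`. -/

theorem hierNorm_sub_le (x y : HierarchicalGroup N) :
    hierNorm (x - y) ≤ max (hierNorm x) (hierNorm y) := by
  have h := hierNorm_add_le x (-y)
  rwa [hierNorm_neg, ← sub_eq_add_neg] at h

/-- Ultrametric isosceles property; it makes the step density constant on balls that miss the
origin. -/
theorem hierNorm_sub_eq_of_lt {x z : HierarchicalGroup N} (h : hierNorm z < hierNorm x) :
    hierNorm (z - x) = hierNorm x := by
  have h1 := hierNorm_sub_le z x
  have h2 := hierNorm_sub_le z (z - x)
  rw [sub_sub_cancel] at h2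
  omega

/-- The `k`-th Haar function: the density of the uniform law on the ball of radius `k` minus that
of the uniform law on the ball of radius `k + 1`. -/
def haarFun (N k : ℕ) (x : HierarchicalGroup N) : ℝ :=
  (if hierNorm x ≤ k then ((N : ℝ) ^ k)⁻¹ else 0) -
    (if hierNorm x ≤ k + 1 then ((N : ℝ) ^ (k + 1))⁻¹ else 0)

theorem haarFun_neg (k : ℕ) (x : HierarchicalGroup N) : haarFun N k (-x) = haarFun N k x := by
  simp [haarFun, hierNorm_neg]

theorem haarFun_zero (k : ℕ) :
    haarFun N k 0 = ((N : ℝ) ^ k)⁻¹ - ((N : ℝ) ^ (k + 1))⁻¹ := by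
  simp [haarFun, hierNorm_zero]

/-- The ball `{x : |x| ≤ k}` as a finite set. -/
def hierBall (N : ℕ) [NeZero N] (k : ℕ) : Finset (HierarchicalGroup N) :=
  (hierBall_finite N k).toFinset

theorem haarFun_eq_zero_of_le {k : ℕ} {x : HierarchicalGroup N} (h : hierNorm x ≤ k) :
    haarFun N k x = haarFun N k 0 := by
  rw [haarFun_zero, haarFun, if_pos h, if_pos (h.trans k.le_succ)]

variable [NeZero N]

theorem mem_hierBall {k : ℕ} {x : HierarchicalGroup N} : x ∈ hierBall N k ↔ hierNorm x ≤ k := by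
  simp [hierBall]

theorem card_hierBall (k : ℕ) : (hierBall N k).card = N ^ k := by
  rw [← hierBall_ncard N k, Set.ncard_eq_toFinset_card _ (hierBall_finite N k)]
  rfl

/-- The probability that `x + Y` lies in the ball of radius `k`, where `Y` has law `P`. -/
def ballMass (P : PMF (HierarchicalGroup N)) (k : ℕ) (x : HierarchicalGroup N) : ℝ :=
  ∑ z ∈ hierBall N k, (P (z - x)).toReal

/-- The expectation of the `k`-th Haar function at `x + Y`, where `Y` has law `P`. -/
def haarMass (P : PMF (HierarchicalGroup N)) (k : ℕ) (x : HierarchicalGroup N) : ℝ :=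
  ((N : ℝ) ^ k)⁻¹ * ballMass P k x - ((N : ℝ) ^ (k + 1))⁻¹ * ballMass P (k + 1) x

theorem inv_pow_succ_le (k : ℕ) : ((N : ℝ) ^ (k + 1))⁻¹ ≤ ((N : ℝ) ^ k)⁻¹ := by
  have : (1 : ℝ) ≤ N := by exact_mod_cast NeZero.one_le
  exact inv_anti₀ (by positivity) (pow_le_pow_right₀ this k.le_succ)

theorem haarFun_zero_nonneg (k : ℕ) : 0 ≤ haarFun N k 0 := by
  rw [haarFun_zero]
  exact sub_nonneg.2 (inv_pow_succ_le k)

theorem haarFun_le_zero (k : ℕ) (x : HierarchicalGroup N) : haarFun N k x ≤ haarFun N k 0 := by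
  have h := inv_pow_succ_le (N := N) k
  have h' : (0 : ℝ) ≤ ((N : ℝ) ^ (k + 1))⁻¹ := by positivity
  rw [haarFun_zero, haarFun]
  split_ifs <;> first | omega | linarith

theorem abs_haarFun_le (k : ℕ) (x : HierarchicalGroup N) : |haarFun N k x| ≤ ((N : ℝ) ^ k)⁻¹ := by
  have h := inv_pow_succ_le (N := N) k
  have h' : (0 : ℝ) ≤ ((N : ℝ) ^ (k + 1))⁻¹ := by positivity
  rw [haarFun, abs_le]
  split_ifs <;> first | omega | constructor <;> linarith

theorem pmf_toReal_summable {α : Type*} (p : PMF α) : Summable fun a => (p a).toReal :=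
  ENNReal.summable_toReal p.tsum_coe_ne_top

theorem pmf_toReal_le_one {α : Type*} (p : PMF α) (a : α) : (p a).toReal ≤ 1 :=
  ENNReal.toReal_le_of_le_ofReal zero_le_one (by simpa using p.coe_le_one a)

theorem pmf_mul_summable {α : Type*} (p : PMF α) {f : α → ℝ} {C : ℝ} (hf : ∀ a, |f a| ≤ C) :
    Summable fun a => (p a).toReal * f a := by
  refine Summable.of_norm_bounded ((pmf_toReal_summable p).mul_right C) fun a => ?_
  rw [norm_mul, Real.norm_of_nonneg ENNReal.toReal_nonneg]
  exact mul_le_mul_of_nonneg_left (hf a) ENNReal.toReal_nonneg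

theorem pmf_bind_toReal {α β : Type*} (p : PMF α) (F : α → PMF β) (b : β) :
    ((p.bind F) b).toReal = ∑' a, (p a).toReal * (F a b).toReal := by
  rw [PMF.bind_apply, ENNReal.tsum_toReal_eq]
  · simp
  · exact fun a => ENNReal.mul_ne_top (p.apply_ne_top a) ((F a).apply_ne_top b)

theorem pmf_bind_summable {α β : Type*} (p : PMF α) (F : α → PMF β) (b : β) :
    Summable fun a => (p a).toReal * (F a b).toReal :=
  pmf_mul_summable p (C := 1) fun a => by
    rw [abs_of_nonneg ENNReal.toReal_nonneg]
    exact pmf_toReal_le_one _ _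

theorem pmf_map_add_apply {S : Type*} [AddCommGroup S] (q : PMF S) (x z : S) :
    (q.map fun y => x + y) z = q (z - x) := by
  classical
  rw [PMF.map_apply, tsum_eq_single (z - x)]
  · simp
  · intro y hy
    rw [if_neg]
    rintro rfl
    exact hy (by abel)

theorem ballMass_summable {α : Type*} (p : PMF α) (F : α → PMF (HierarchicalGroup N)) (k : ℕ)
    (x : HierarchicalGroup N) : Summable fun a => (p a).toReal * ballMass (F a) k x := by
  simp only [ballMass, Finset.mul_sum]
  exact summable_sum fun z _ => pmf_bind_summable p F (z - x)

theorem ballMass_bind {α : Type*} (p : PMF α) (F : α → PMF (HierarchicalGroup N)) (k : ℕ)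
    (x : HierarchicalGroup N) :
    ballMass (p.bind F) k x = ∑' a, (p a).toReal * ballMass (F a) k x := by
  simp only [ballMass, Finset.mul_sum, pmf_bind_toReal]
  exact (Summable.tsum_finsetSum fun z _ => pmf_bind_summable p F (z - x)).symm

theorem haarMass_bind {α : Type*} (p : PMF α) (F : α → PMF (HierarchicalGroup N)) (k : ℕ)
    (x : HierarchicalGroup N) :
    haarMass (p.bind F) k x = ∑' a, (p a).toReal * haarMass (F a) k x := by
  simp only [haarMass, ballMass_bind, ← tsum_mul_left]
  rw [← Summable.tsum_sub ((ballMass_summable p F k x).mul_left _)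
    ((ballMass_summable p F (k + 1) x).mul_left _)]
  exact tsum_congr fun a => by ring

theorem ballMass_map_add (q : PMF (HierarchicalGroup N)) (k : ℕ) (x y : HierarchicalGroup N) :
    ballMass (q.map fun z => y + z) k x = ballMass q k (x + y) := by
  simp only [ballMass, pmf_map_add_apply, sub_sub]

theorem haarMass_map_add (q : PMF (HierarchicalGroup N)) (k : ℕ) (x y : HierarchicalGroup N) :
    haarMass (q.map fun z => y + z) k x = haarMass q k (x + y) := by
  simp only [haarMass, ballMass_map_add]

theorem ballMass_pure_zero (k : ℕ) (x : HierarchicalGroup N) :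
    ballMass (PMF.pure 0) k x = if hierNorm x ≤ k then 1 else 0 := by
  classical
  have h : ∀ z, ((PMF.pure (0 : HierarchicalGroup N)) (z - x)).toReal = if z = x then 1 else 0 := by
    intro z
    rw [PMF.pure_apply]
    simp only [sub_eq_zero]
    split_ifs <;> simp
  simp only [ballMass, h, Finset.sum_ite_eq', mem_hierBall]

theorem haarMass_pure_zero (k : ℕ) (x : HierarchicalGroup N) :
    haarMass (PMF.pure 0) k x = haarFun N k x := by
  simp only [haarMass, ballMass_pure_zero, haarFun]
  split_ifs <;> simp

/-- Writing `P` as a mixture of point masses turns the finite-sum definition into an expectation;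
the induction on steps folds back through this form. -/
theorem haarMass_eq_tsum (P : PMF (HierarchicalGroup N)) (k : ℕ) (x : HierarchicalGroup N) :
    haarMass P k x = ∑' y, (P y).toReal * haarFun N k (x + y) := by
  conv_lhs => rw [← PMF.bind_pure P, haarMass_bind]
  refine tsum_congr fun y => ?_
  rw [← haarMass_pure_zero, ← haarMass_map_add]
  congr 2
  rw [PMF.pure_map, add_zero]

/-- Telescoping, with the ball of radius `0` reduced to a point: this is how point probabilities are
recovered from Haar components. -/
theorem sum_haarMass (P : PMF (HierarchicalGroup N)) (K : ℕ) (x : HierarchicalGroup N) :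
    ∑ k ∈ Finset.range K, haarMass P k x = (P (-x)).toReal - ((N : ℝ) ^ K)⁻¹ * ballMass P K x := by
  have h0 : ballMass P 0 x = (P (-x)).toReal := by
    have : hierBall N 0 = {0} := by
      ext z
      rw [mem_hierBall, Finset.mem_singleton, Nat.le_zero, hierNorm_eq_zero]
    simp [ballMass, this]
  simp only [haarMass]
  rw [Finset.sum_range_sub' (fun k => ((N : ℝ) ^ k)⁻¹ * ballMass P k x), h0]
  simp

theorem ballMass_nonneg (P : PMF (HierarchicalGroup N)) (k : ℕ) (x : HierarchicalGroup N) :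
    0 ≤ ballMass P k x :=
  Finset.sum_nonneg fun _ _ => ENNReal.toReal_nonneg

theorem ballMass_le_one (P : PMF (HierarchicalGroup N)) (k : ℕ) (x : HierarchicalGroup N) :
    ballMass P k x ≤ 1 := by
  have h : ballMass P k x = ∑ z ∈ (hierBall N k).map (Equiv.subRight x).toEmbedding,
      (P z).toReal := by
    rw [Finset.sum_map]
    rfl
  rw [h]
  refine ((pmf_toReal_summable P).sum_le_tsum _ fun _ _ => ENNReal.toReal_nonneg).trans ?_
  rw [← ENNReal.tsum_toReal_eq fun a => P.apply_ne_top a, P.tsum_coe]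
  simp

theorem hasSum_haarMass (hN : 2 ≤ N) (P : PMF (HierarchicalGroup N)) (x : HierarchicalGroup N)
    (hs : Summable fun k => haarMass P k x) :
    HasSum (fun k => haarMass P k x) (P (-x)).toReal := by
  have hN1 : (1 : ℝ) < N := by exact_mod_cast (by omega : 1 < N)
  rw [hs.hasSum_iff_tendsto_nat]
  simp only [sum_haarMass]
  have hz : Tendsto (fun K => ((N : ℝ) ^ K)⁻¹ * ballMass P K x) atTop (nhds 0) := by
    have h1 : Tendsto (fun K : ℕ => ((N : ℝ) ^ K)⁻¹) atTop (nhds 0) :=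
      (tendsto_pow_atTop_atTop_of_one_lt hN1).inv_tendsto_atTop
    refine squeeze_zero (fun K => mul_nonneg (by positivity) (ballMass_nonneg P K x))
      (fun K => ?_) h1
    exact mul_le_of_le_one_right (by positivity) (ballMass_le_one P K x)
  simpa using tendsto_const_nhds.sub hz

end Haar

/-! ### Spectral representation of hierarchical walks -/

section Spectral

/-- The rate at which the walk with jump radius law `r` damps the `k`-th Haar function. -/
def haarRate (N : ℕ) (r : PMF ℕ) (k : ℕ) : ℝ :=
  1 - (∑ i ∈ Finset.range k, (r i).toReal - (r k).toReal / ((N : ℝ) - 1))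

variable {N : ℕ}

theorem stepPMF_toReal (hN : 2 ≤ N) (r : PMF ℕ) {y : HierarchicalGroup N} {j : ℕ}
    (hy : hierNorm y = j + 1) :
    (stepPMF hN r y).toReal = (r j).toReal / ((N : ℝ) ^ j * ((N : ℝ) - 1)) := by
  have h0 : y ≠ 0 := by
    rintro rfl
    rw [hierNorm_zero] at hy
    omega
  have h1 : 1 ≤ N := by omega
  change (stepWeight N r y).toReal = _
  simp [stepWeight, h0, hy, ENNReal.toReal_div, Nat.cast_sub h1, -ENNReal.natCast_sub]

theorem stepPMF_zero (hN : 2 ≤ N) (r : PMF ℕ) : stepPMF hN r 0 = 0 := by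
  change stepWeight N r 0 = 0
  simp [stepWeight]

theorem tsum_range_compl_radius (r : PMF ℕ) (k : ℕ) :
    1 - ∑ i ∈ Finset.range k, (r i).toReal = ∑' i, (r (i + k)).toReal := by
  have h := (pmf_toReal_summable r).sum_add_tsum_nat_add k
  rw [← ENNReal.tsum_toReal_eq fun a => r.apply_ne_top a, r.tsum_coe, ENNReal.toReal_one] at h
  linarith

/-- All terms are nonnegative here, which yields both positivity of the rate and its asymptotics. -/
theorem haarRate_eq (hN : 2 ≤ N) (r : PMF ℕ) (k : ℕ) :
    haarRate N r k = (r k).toReal * (N / ((N : ℝ) - 1)) + ∑' i, (r (i + (k + 1))).toReal := by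
  have hN1 : (N : ℝ) - 1 ≠ 0 := by
    have : (1 : ℝ) < N := by exact_mod_cast (by omega : 1 < N)
    linarith
  rw [← tsum_range_compl_radius, haarRate, Finset.sum_range_succ]
  field_simp
  ring

theorem mul_le_haarRate (hN : 2 ≤ N) (r : PMF ℕ) (k : ℕ) : (r k).toReal ≤ haarRate N r k := by
  have hN1 : (0 : ℝ) < (N : ℝ) - 1 := by
    have : (1 : ℝ) < N := by exact_mod_cast (by omega : 1 < N)
    linarith
  rw [haarRate_eq hN]
  have h1 : (1 : ℝ) ≤ N / ((N : ℝ) - 1) := by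
    rw [le_div_iff₀ hN1]
    linarith
  have h2 : 0 ≤ ∑' i, (r (i + (k + 1))).toReal := tsum_nonneg fun _ => ENNReal.toReal_nonneg
  nlinarith [ENNReal.toReal_nonneg (a := r k)]

theorem haarRate_nonneg (hN : 2 ≤ N) (r : PMF ℕ) (k : ℕ) : 0 ≤ haarRate N r k :=
  ENNReal.toReal_nonneg.trans (mul_le_haarRate hN r k)

theorem summable_inv_pow (hN : 2 ≤ N) : Summable fun k : ℕ => ((N : ℝ) ^ k)⁻¹ := by
  have hN1 : (1 : ℝ) < N := by exact_mod_cast (by omega : 1 < N)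
  simp only [← inv_pow]
  exact summable_geometric_of_lt_one (by positivity) (inv_lt_one_of_one_lt₀ hN1)

variable [NeZero N]

theorem sum_hierBall_stepPMF (hN : 2 ≤ N) (r : PMF ℕ) (k : ℕ) :
    ∑ z ∈ hierBall N k, (stepPMF hN r z).toReal = ∑ i ∈ Finset.range k, (r i).toReal := by
  classical
  have hN0 : (0 : ℝ) < N := by exact_mod_cast (by omega : 0 < N)
  have hN1 : (0 : ℝ) < (N : ℝ) - 1 := by
    have : (1 : ℝ) < N := by exact_mod_cast (by omega : 1 < N)
    linarith
  induction k with
  | zero =>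
    have : hierBall N 0 = {0} := by
      ext z
      rw [mem_hierBall, Finset.mem_singleton, Nat.le_zero, hierNorm_eq_zero]
    simp [this, stepPMF_zero]
  | succ k ih =>
    have hsub : hierBall N k ⊆ hierBall N (k + 1) := fun z hz =>
      mem_hierBall.2 ((mem_hierBall.1 hz).trans k.le_succ)
    rw [← Finset.sum_sdiff hsub, ih, Finset.sum_range_succ, add_comm]
    congr 1
    have hc : ∀ z ∈ hierBall N (k + 1) \ hierBall N k,
        (stepPMF hN r z).toReal = (r k).toReal / ((N : ℝ) ^ k * ((N : ℝ) - 1)) := by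
      intro z hz
      rw [Finset.mem_sdiff, mem_hierBall, mem_hierBall] at hz
      exact stepPMF_toReal hN r (by omega)
    rw [Finset.sum_congr rfl hc, Finset.sum_const, Finset.card_sdiff_of_subset hsub, card_hierBall,
      card_hierBall, nsmul_eq_mul, Nat.cast_sub (Nat.pow_le_pow_right (by omega) k.le_succ)]
    push_cast
    rw [pow_succ]
    field_simp

/-- The ball is a subgroup, so translation by one of its elements permutes it. -/
theorem ballMass_stepPMF_of_le (hN : 2 ≤ N) (r : PMF ℕ) {k : ℕ} {x : HierarchicalGroup N}
    (hx : hierNorm x ≤ k) :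
    ballMass (stepPMF hN r) k x = ∑ i ∈ Finset.range k, (r i).toReal := by
  rw [← sum_hierBall_stepPMF hN r k, ballMass]
  refine Finset.sum_bij' (fun z _ => z - x) (fun z _ => z + x) ?_ ?_ ?_ ?_ ?_
  · intro z hz
    rw [mem_hierBall] at hz ⊢
    exact (hierNorm_sub_le z x).trans (max_le hz hx)
  · intro z hz
    rw [mem_hierBall] at hz ⊢
    exact (hierNorm_add_le z x).trans (max_le hz hx)
  · simp
  · simp
  · simp

theorem ballMass_stepPMF_of_lt (hN : 2 ≤ N) (r : PMF ℕ) {k j : ℕ} {x : HierarchicalGroup N}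
    (hx : hierNorm x = j + 1) (hk : k < j + 1) :
    ballMass (stepPMF hN r) k x =
      (N : ℝ) ^ k * ((r j).toReal / ((N : ℝ) ^ j * ((N : ℝ) - 1))) := by
  rw [ballMass, Finset.sum_congr rfl (g := fun _ => (r j).toReal / ((N : ℝ) ^ j * ((N : ℝ) - 1))),
    Finset.sum_const, card_hierBall]
  · simp
  · intro z hz
    rw [mem_hierBall] at hz
    exact stepPMF_toReal hN r ((hierNorm_sub_eq_of_lt (by omega)).trans hx)

/-- The Haar functions are eigenfunctions of the step. -/
theorem haarMass_stepPMF (hN : 2 ≤ N) (r : PMF ℕ) (k : ℕ) (x : HierarchicalGroup N) :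
    haarMass (stepPMF hN r) k x = (1 - haarRate N r k) * haarFun N k x := by
  have hN0 : (N : ℝ) ≠ 0 := by exact_mod_cast (by omega : N ≠ 0)
  have hN1 : (N : ℝ) - 1 ≠ 0 := by
    have : (1 : ℝ) < N := by exact_mod_cast (by omega : 1 < N)
    linarith
  rw [haarMass, haarFun, haarRate]
  rcases le_or_gt (hierNorm x) k with h | h
  · rw [ballMass_stepPMF_of_le hN r h, ballMass_stepPMF_of_le hN r (h.trans k.le_succ),
      if_pos h, if_pos (h.trans k.le_succ), Finset.sum_range_succ]
    field_simp
    ring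
  · obtain ⟨j, hj⟩ : ∃ j, hierNorm x = j + 1 := ⟨hierNorm x - 1, by omega⟩
    rw [ballMass_stepPMF_of_lt hN r hj (by omega), if_neg h.not_ge]
    -- On the shell of radius `k + 1` only the larger ball contains `x`. Farther out both translated
    -- balls see the same constant density, and the normalised masses cancel.
    rcases (show k = j ∨ k + 1 < j + 1 by omega) with rfl | h'
    · rw [ballMass_stepPMF_of_le hN r hj.le, if_pos hj.le, Finset.sum_range_succ]
      field_simp
      ring
    · rw [ballMass_stepPMF_of_lt hN r hj h', if_neg (by omega)]
      field_simp
      ring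

theorem haarMass_nStepPMF (hN : 2 ≤ N) (r : PMF ℕ) (k n : ℕ) (x : HierarchicalGroup N) :
    haarMass (nStepPMF (stepPMF hN r) n) k x = (1 - haarRate N r k) ^ n * haarFun N k x := by
  induction n generalizing x with
  | zero => simp [nStepPMF, haarMass_pure_zero]
  | succ n ih =>
    rw [nStepPMF, haarMass_bind]
    simp only [haarMass_map_add, haarMass_stepPMF, mul_left_comm _ (1 - haarRate N r k)]
    rw [tsum_mul_left, ← haarMass_eq_tsum, ih, pow_succ', mul_assoc]

/-- The Poisson generating function at the eigenvalue: the mean of `(1 - h)^n` is `exp(-h t)`. -/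
theorem haarMass_walkPMF (hN : 2 ≤ N) (r : PMF ℕ) (k : ℕ) {t : ℝ} (ht : 0 ≤ t)
    (x : HierarchicalGroup N) :
    haarMass (walkPMF (stepPMF hN r) t) k x =
      Real.exp (-(haarRate N r k * t)) * haarFun N k x := by
  rw [walkPMF, haarMass_bind]
  simp only [haarMass_nStepPMF, ← mul_assoc]
  rw [tsum_mul_right]
  congr 1
  have hp : ∀ n : ℕ, ((ProbabilityTheory.poissonMeasure t.toNNReal).toPMF n).toReal =
      Real.exp (-t) * (t ^ n / n.factorial) := by
    intro n
    rw [Measure.toPMF_apply, ← measureReal_def, ProbabilityTheory.poissonMeasure_real_singleton,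
      Real.coe_toNNReal t ht, mul_div_assoc]
  simp only [hp]
  have he := NormedSpace.expSeries_div_hasSum_exp (𝔸 := ℝ) (t * (1 - haarRate N r k))
  rw [← Real.exp_eq_exp_ℝ] at he
  refine Eq.trans (tsum_congr fun n => ?_)
    ((he.mul_left (Real.exp (-t))).tsum_eq.trans ?_)
  · rw [mul_pow]
    ring
  · rw [← Real.exp_add]
    congr 1
    ring

theorem abs_exp_mul_haarFun_le (hN : 2 ≤ N) (r : PMF ℕ) {t : ℝ} (ht : 0 ≤ t)
    (x : HierarchicalGroup N) (k : ℕ) :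
    |Real.exp (-(haarRate N r k * t)) * haarFun N k x| ≤ ((N : ℝ) ^ k)⁻¹ := by
  rw [abs_mul, abs_of_pos (Real.exp_pos _), ← one_mul (((N : ℝ) ^ k)⁻¹)]
  refine mul_le_mul ?_ (abs_haarFun_le k x) (abs_nonneg _) zero_le_one
  rw [Real.exp_le_one_iff]
  have := mul_nonneg (haarRate_nonneg hN r k) ht
  linarith

/-- The transition probabilities as mixtures of exponentials. -/
theorem hasSum_walkPMF (hN : 2 ≤ N) (r : PMF ℕ) {t : ℝ} (ht : 0 ≤ t) (x : HierarchicalGroup N) :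
    HasSum (fun k => Real.exp (-(haarRate N r k * t)) * haarFun N k x)
      (walkPMF (stepPMF hN r) t x).toReal := by
  have h := hasSum_haarMass hN (walkPMF (stepPMF hN r) t) (-x)
  simp only [haarMass_walkPMF hN r _ ht, haarFun_neg, neg_neg] at h
  exact h (Summable.of_norm_bounded (summable_inv_pow hN)
    (abs_exp_mul_haarFun_le hN r ht x))

/-- Every Haar function is maximal at `0` and enters with a positive damping factor. -/
theorem walkPMF_le_zero (hN : 2 ≤ N) (r : PMF ℕ) {t : ℝ} (ht : 0 ≤ t) (x : HierarchicalGroup N) :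
    walkPMF (stepPMF hN r) t x ≤ walkPMF (stepPMF hN r) t 0 := by
  rw [← ENNReal.toReal_le_toReal (PMF.apply_ne_top _ _) (PMF.apply_ne_top _ _)]
  exact hasSum_le (fun k => mul_le_mul_of_nonneg_left (haarFun_le_zero k x) (Real.exp_pos _).le)
    (hasSum_walkPMF hN r ht x) (hasSum_walkPMF hN r ht 0)

/-- Haar functions of index at least `hierNorm x` agree at `0` and `x`, so only finitely many
exponentials separate the two probabilities. Divergence of the potential at `0` thereby passes to
every `x`. -/
theorem walkPMF_zero_le (hN : 2 ≤ N) (r : PMF ℕ) {t : ℝ} (ht : 0 ≤ t) (x : HierarchicalGroup N) :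
    walkPMF (stepPMF hN r) t 0 ≤ walkPMF (stepPMF hN r) t x +
      ∑ k ∈ Finset.range (hierNorm x), ENNReal.ofReal (2 * Real.exp (-(haarRate N r k * t))) := by
  have h0 := hasSum_walkPMF hN r ht 0
  have hx := hasSum_walkPMF hN r ht x
  have hN1 : (1 : ℝ) ≤ N := by exact_mod_cast (by omega : 1 ≤ N)
  have hd : HasSum (fun k => Real.exp (-(haarRate N r k * t)) * haarFun N k 0 -
      Real.exp (-(haarRate N r k * t)) * haarFun N k x)
      (∑ k ∈ Finset.range (hierNorm x), (Real.exp (-(haarRate N r k * t)) * haarFun N k 0 -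
      Real.exp (-(haarRate N r k * t)) * haarFun N k x)) := by
    refine hasSum_sum_of_ne_finset_zero fun k hk => ?_
    rw [haarFun_eq_zero_of_le (x := x) (by simpa using hk), sub_self]
  have he := (h0.sub hx).unique hd
  have hle : (walkPMF (stepPMF hN r) t 0).toReal ≤ (walkPMF (stepPMF hN r) t x).toReal +
      ∑ k ∈ Finset.range (hierNorm x), 2 * Real.exp (-(haarRate N r k * t)) := by
    rw [← sub_le_iff_le_add', he]
    refine Finset.sum_le_sum fun k _ => ?_
    have hp := Real.exp_pos (-(haarRate N r k * t))
    have hk : ((N : ℝ) ^ k)⁻¹ ≤ 1 := inv_le_one_of_one_le₀ (one_le_pow₀ hN1)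
    have a1 := (abs_le.1 (abs_haarFun_le (N := N) k 0)).2
    have a2 := (abs_le.1 (abs_haarFun_le (N := N) k x)).1
    rw [← mul_sub, mul_comm]
    exact mul_le_mul_of_nonneg_right (by linarith) hp.le
  rw [← ENNReal.ofReal_sum_of_nonneg fun k _ => by positivity]
  calc walkPMF (stepPMF hN r) t 0 = ENNReal.ofReal (walkPMF (stepPMF hN r) t 0).toReal :=
        (ENNReal.ofReal_toReal (PMF.apply_ne_top _ _)).symm
    _ ≤ _ := ENNReal.ofReal_le_ofReal hle
    _ = _ := by
      rw [ENNReal.ofReal_add ENNReal.toReal_nonneg (Finset.sum_nonneg fun k _ => by positivity),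
        ENNReal.ofReal_toReal (PMF.apply_ne_top _ _)]

end Spectral

/-! ### Asymptotics of the damping rates -/

section Rates

/-- The normalizing constant of the jump radius law. -/
def radiusConst (N : ℕ) (μ β : ℝ) : ℝ :=
  (∑' j, ENNReal.ofReal (radiusWeight μ (powSeq β) N j))⁻¹.toReal

theorem radiusConst_pos {N : ℕ} (hN : 2 ≤ N) {μ : ℝ} (hμ : 0 < μ) (β : ℝ) : 0 < radiusConst N μ β := by
  refine ENNReal.toReal_pos ?_ ?_
  · exact ENNReal.inv_ne_zero.2 (radiusWeight_powSeq_summable hN hμ β).tsum_ofReal_ne_top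
  · refine ENNReal.inv_ne_top.2 fun h => ?_
    have := ENNReal.tsum_eq_zero.1 h 0
    rw [ENNReal.ofReal_eq_zero] at this
    exact this.not_gt (radiusWeight_powSeq_pos hN μ β 0)

theorem radiusWeight_add_div {N : ℕ} (hN : 2 ≤ N) (μ β : ℝ) (k i : ℕ) :
    radiusWeight μ (powSeq β) N (i + (k + 1)) / radiusWeight μ (powSeq β) N k =
      (1 + ((i : ℝ) + 1) / ((k : ℝ) + 1)) ^ β / (N : ℝ) ^ (((i : ℝ) + 1) / μ) := by
  have hN0 : (0 : ℝ) < N := by exact_mod_cast (by omega : 0 < N)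
  have hk : (0 : ℝ) < (k : ℝ) + 1 := by positivity
  have e1 : (1 + ((i : ℝ) + 1) / ((k : ℝ) + 1)) =
      (((i + (k + 1) : ℕ) : ℝ) + 1) / ((k : ℝ) + 1) := by
    push_cast
    field_simp
    ring
  have e2 : (((i + (k + 1) : ℕ) : ℝ) / μ) = ((i : ℝ) + 1) / μ + (k : ℝ) / μ := by
    push_cast
    ring
  rw [radiusWeight, radiusWeight, powSeq, powSeq, e1, e2, Real.rpow_add hN0,
    Real.div_rpow (by positivity) hk.le]
  have := Real.rpow_pos_of_pos hk β
  have := Real.rpow_pos_of_pos hN0 ((k : ℝ) / μ)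
  field_simp

theorem tendsto_tsum_radiusWeight_div {N : ℕ} (hN : 2 ≤ N) {μ : ℝ} (hμ : 0 < μ) {β : ℝ}
    (hβ : 0 < β) :
    Tendsto (fun k : ℕ => ∑' i : ℕ,
      radiusWeight μ (powSeq β) N (i + (k + 1)) / radiusWeight μ (powSeq β) N k) atTop
      (nhds (∑' i : ℕ, 1 / (N : ℝ) ^ (((i : ℝ) + 1) / μ))) := by
  simp only [radiusWeight_add_div hN]
  have hN0 : (0 : ℝ) < N := by exact_mod_cast (by omega : 0 < N)
  -- Since `(i+1)/(k+1) ≤ i+1`, each ratio is at most `radiusWeight` at `i + 1`, a summable bound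
  -- independent of `k`.
  refine tendsto_tsum_of_dominated_convergence
    ((summable_nat_add_iff 1).2 (radiusWeight_powSeq_summable hN hμ β)) (fun i => ?_)
    (Eventually.of_forall fun k i => ?_)
  · refine Tendsto.div_const ?_ _
    have h1 : Tendsto (fun k : ℕ => 1 + ((i : ℝ) + 1) / ((k : ℝ) + 1)) atTop (nhds (1 + 0)) :=
      tendsto_const_nhds.add (Tendsto.div_atTop tendsto_const_nhds
        (tendsto_atTop_add_const_right _ _ tendsto_natCast_atTop_atTop))
    rw [add_zero] at h1
    simpa using h1.rpow_const (p := β) (Or.inl one_ne_zero)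
  · rw [Real.norm_of_nonneg (by positivity), radiusWeight, powSeq]
    push_cast
    have h1 : ((i : ℝ) + 1) / ((k : ℝ) + 1) ≤ (i : ℝ) + 1 :=
      div_le_self (by positivity) (by linarith [k.cast_nonneg (α := ℝ)])
    gcongr ?_ ^ _ / _
    linarith

variable {N : ℕ} (hN : 2 ≤ N) {μ : ℝ} (hμ : 0 < μ) (β : ℝ)

/-- The rates at which the `(μ, ((j+1)^β), N)`-random walk damps the Haar functions. -/
def powRate (k : ℕ) : ℝ :=
  haarRate N (radiusPMF μ (powSeq β) N (radiusWeight_powSeq_pos hN μ β)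
    (radiusWeight_powSeq_summable hN hμ β)) k

theorem radiusPMF_toReal (k : ℕ) :
    (radiusPMF μ (powSeq β) N (radiusWeight_powSeq_pos hN μ β)
      (radiusWeight_powSeq_summable hN hμ β) k).toReal =
      radiusConst N μ β * radiusWeight μ (powSeq β) N k := by
  rw [radiusPMF, PMF.normalize_apply, ENNReal.toReal_mul,
    ENNReal.toReal_ofReal (radiusWeight_powSeq_pos hN μ β k).le, mul_comm]
  rfl

theorem mul_radiusWeight_le_powRate (k : ℕ) :
    radiusConst N μ β * radiusWeight μ (powSeq β) N k ≤ powRate hN hμ β k := by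
  rw [← radiusPMF_toReal hN hμ]
  exact mul_le_haarRate hN _ k

theorem powRate_pos (k : ℕ) : 0 < powRate hN hμ β k :=
  (mul_pos (radiusConst_pos hN hμ β) (radiusWeight_powSeq_pos hN μ β k)).trans_le
    (mul_radiusWeight_le_powRate hN hμ β k)

/-- The tail of the radius law is comparable to its leading term, not negligible, so it enters the
constant through the geometric sum `S`. -/
theorem powRate_isEquivalent (hβ : 0 < β) : ∃ A : ℝ, 0 < A ∧
    powRate hN hμ β ~[atTop] fun k => A * radiusWeight μ (powSeq β) N k := by
  have hN1 : (0 : ℝ) < (N : ℝ) - 1 := by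
    have : (1 : ℝ) < N := by exact_mod_cast (by omega : 1 < N)
    linarith
  have hN0 : (0 : ℝ) < N := by linarith
  have hD := radiusConst_pos hN hμ β
  have hS : 0 ≤ ∑' i : ℕ, 1 / (N : ℝ) ^ (((i : ℝ) + 1) / μ) := tsum_nonneg fun i => by positivity
  set S := ∑' i : ℕ, 1 / (N : ℝ) ^ (((i : ℝ) + 1) / μ)
  have hA : 0 < radiusConst N μ β * (N / ((N : ℝ) - 1) + S) := by positivity
  refine ⟨_, hA, isEquivalent_of_tendsto_one ?_⟩
  have ht := ((tendsto_tsum_radiusWeight_div hN hμ hβ).const_add (N / ((N : ℝ) - 1))).const_mul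
    (radiusConst N μ β)
  have ht' := ht.div_const (radiusConst N μ β * (N / ((N : ℝ) - 1) + S))
  rw [div_self hA.ne'] at ht'
  refine ht'.congr fun k => ?_
  have hw := radiusWeight_powSeq_pos hN μ β k
  simp only [Pi.div_apply, powRate, haarRate_eq hN, radiusPMF_toReal hN hμ, tsum_mul_left, tsum_div_const]
  field_simp

/-- The contribution of the `k`-th Haar function to the potential of order `ζ`. -/
def potCoeff (ζ : ℝ) (k : ℕ) : ℝ :=
  haarFun N k 0 * powRate hN hμ β k ^ (-ζ)

theorem potCoeff_nonneg (ζ : ℝ) (k : ℕ) : 0 ≤ potCoeff hN hμ β ζ k := by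
  have : NeZero N := ⟨by omega⟩
  exact mul_nonneg (haarFun_zero_nonneg k) (Real.rpow_nonneg (powRate_pos hN hμ β k).le _)

theorem potCoeff_isEquivalent (hβ : 0 < β) (ζ : ℝ) : ∃ A : ℝ, 0 < A ∧
    potCoeff hN hμ β ζ ~[atTop]
      fun k : ℕ => A * (((k : ℝ) + 1) ^ (-(β * ζ)) * (N : ℝ) ^ ((k : ℝ) * (ζ / μ - 1))) := by
  have hN0 : (0 : ℝ) < N := by exact_mod_cast (by omega : 0 < N)
  have hN1 : (1 : ℝ) < N := by exact_mod_cast (by omega : 1 < N)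
  obtain ⟨A, hA, h⟩ := powRate_isEquivalent hN hμ β hβ
  have hw := radiusWeight_powSeq_pos hN μ β
  have h1 := h.rpow (r := -ζ) fun k => (mul_pos hA (hw k)).le
  have h2 := (IsEquivalent.refl (u := fun k : ℕ => haarFun N k 0) (l := atTop)).mul h1
  -- The factor `1 - N⁻¹` comes from `haarFun N k 0 = N^(-k) (1 - N⁻¹)`.
  have hB : 0 < A ^ (-ζ) * (1 - (N : ℝ)⁻¹) :=
    mul_pos (Real.rpow_pos_of_pos hA _) (sub_pos.2 (inv_lt_one_of_one_lt₀ hN1))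
  refine ⟨_, hB, ?_⟩
  convert! h2 using 1
  funext k
  have hk : (0 : ℝ) < (k : ℝ) + 1 := by positivity
  simp only [Pi.mul_apply, Pi.pow_apply]
  have e : (N : ℝ) ^ ((k : ℝ) * (ζ / μ - 1)) = (N : ℝ) ^ ((k : ℝ) / μ * ζ) * ((N : ℝ) ^ k)⁻¹ := by
    rw [← Real.rpow_natCast, ← Real.rpow_neg hN0.le, ← Real.rpow_add hN0]
    congr 1
    ring
  rw [e, haarFun_zero, Real.mul_rpow hA.le (hw k).le, radiusWeight, powSeq,
    Real.div_rpow (by positivity) (by positivity), ← Real.rpow_mul hk.le, ← Real.rpow_mul hN0.le,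
    mul_neg, mul_neg, Real.rpow_neg hN0.le (_ * _), pow_succ]
  have := Real.rpow_pos_of_pos hN0 ((k : ℝ) / μ * ζ)
  field_simp

theorem summable_potCoeff_iff (hβ : 0 < β) (ζ : ℝ) : Summable (potCoeff hN hμ β ζ) ↔
    Summable fun k : ℕ => ((k : ℝ) + 1) ^ (-(β * ζ)) * (N : ℝ) ^ ((k : ℝ) * (ζ / μ - 1)) := by
  obtain ⟨A, hA, h⟩ := potCoeff_isEquivalent hN hμ β hβ ζ
  rw [h.summable_iff_nat, summable_mul_left_iff hA.ne']

/-- The comparison series is again a `radiusWeight` series, with `(1 - ζ/μ)⁻¹` in place of `μ` and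
`-(βζ)` in place of `β`. -/
theorem summable_potCoeff_of_lt (hβ : 0 < β) {ζ : ℝ} (hζ : ζ < μ) :
    Summable (potCoeff hN hμ β ζ) := by
  rw [summable_potCoeff_iff hN hμ β hβ]
  have hN0 : (0 : ℝ) < N := by exact_mod_cast (by omega : 0 < N)
  have h : 0 < 1 - ζ / μ := sub_pos.2 ((div_lt_one hμ).2 hζ)
  convert! radiusWeight_powSeq_summable hN (inv_pos.2 h) (-(β * ζ)) using 2 with k
  rw [radiusWeight, powSeq, div_inv_eq_mul, div_eq_mul_inv (_ ^ _), ← Real.rpow_neg hN0.le,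
    ← mul_neg (k : ℝ), neg_sub]

/-- The reciprocals of the comparison terms form a summable `radiusWeight` series; were the terms
summable too, both factors of a product equal to 1 would tend to 0. -/
theorem not_summable_potCoeff_of_gt (hβ : 0 < β) {ζ : ℝ} (hζ : μ < ζ) :
    ¬ Summable (potCoeff hN hμ β ζ) := by
  rw [summable_potCoeff_iff hN hμ β hβ]
  intro hs
  have hN0 : (0 : ℝ) < N := by exact_mod_cast (by omega : 0 < N)
  have h : 0 < ζ / μ - 1 := sub_pos.2 ((one_lt_div hμ).2 hζ)
  have h1 := (radiusWeight_powSeq_summable hN (inv_pos.2 h) (β * ζ)).tendsto_atTop_zero.mul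
    hs.tendsto_atTop_zero
  have h2 := h1.congr' (f₂ := fun _ => (1 : ℝ)) (Eventually.of_forall fun k => ?_)
  · simpa using tendsto_nhds_unique h2 tendsto_const_nhds
  · have hk : (0 : ℝ) < (k : ℝ) + 1 := by positivity
    simp only [radiusWeight, powSeq]
    rw [div_inv_eq_mul, Real.rpow_neg hk.le]
    have := Real.rpow_pos_of_pos hN0 ((k : ℝ) * (ζ / μ - 1))
    have := Real.rpow_pos_of_pos hk (β * ζ)
    field_simp

theorem summable_potCoeff_self_iff (hβ : 0 < β) :
    Summable (potCoeff hN hμ β μ) ↔ 1 / μ < β := by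
  rw [summable_potCoeff_iff hN hμ β hβ, div_lt_iff₀ hμ, ← Real.summable_one_div_nat_add_rpow 1]
  refine summable_congr fun k => ?_
  have hk : (0 : ℝ) < (k : ℝ) + 1 := by positivity
  rw [div_self hμ.ne', sub_self, mul_zero, Real.rpow_zero, mul_one, abs_of_pos hk,
    Real.rpow_neg hk.le, one_div]

end Rates

/-! ### Powers of the Green operator -/

section Green

theorem integrableOn_rpow_mul_exp {ζ h : ℝ} (hζ : 0 < ζ) (hh : 0 < h) :
    IntegrableOn (fun t : ℝ => t ^ (ζ - 1) * Real.exp (-(h * t))) (Set.Ioi 0) := by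
  -- A non-integrable function has integral 0 by convention, against the positive value of the Gamma
  -- integral.
  by_contra hc
  have h1 := Real.integral_rpow_mul_exp_neg_mul_Ioi hζ hh
  rw [integral_undef hc] at h1
  have h2 := Real.Gamma_pos_of_pos hζ
  have h3 : 0 < (1 / h) ^ ζ * Real.Gamma ζ := by positivity
  exact h3.ne h1

theorem lintegral_rpow_mul_exp {ζ h : ℝ} (hζ : 0 < ζ) (hh : 0 < h) :
    ∫⁻ t in Set.Ioi (0 : ℝ), ENNReal.ofReal (t ^ (ζ - 1)) * ENNReal.ofReal (Real.exp (-(h * t))) =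
      ENNReal.ofReal (h ^ (-ζ) * Real.Gamma ζ) := by
  have h1 : h ^ (-ζ) = (1 / h) ^ ζ := by rw [one_div, Real.inv_rpow hh.le, Real.rpow_neg hh.le]
  rw [h1, ← Real.integral_rpow_mul_exp_neg_mul_Ioi hζ hh,
    ofReal_integral_eq_lintegral_ofReal (integrableOn_rpow_mul_exp hζ hh)]
  · refine setLIntegral_congr_fun measurableSet_Ioi fun t ht => ?_
    exact (ENNReal.ofReal_mul (Real.rpow_nonneg (le_of_lt ht) _)).symm
  · refine (ae_restrict_mem measurableSet_Ioi).mono fun t ht => ?_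
    exact mul_nonneg (Real.rpow_nonneg (le_of_lt ht) _) (Real.exp_pos _).le

theorem tsum_ofReal_ne_top_iff {f : ℕ → ℝ} (hf : ∀ k, 0 ≤ f k) :
    ∑' k, ENNReal.ofReal (f k) ≠ ∞ ↔ Summable f := by
  refine ⟨fun h => ?_, fun h => h.tsum_ofReal_ne_top⟩
  simpa only [ENNReal.toReal_ofReal (hf _)] using ENNReal.summable_toReal h

theorem finite_of_isBounded_hierarchicalGroup {N : ℕ} [NeZero N] {s : Set (HierarchicalGroup N)}
    (hs : Bornology.IsBounded s) : s.Finite := by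
  obtain ⟨R, hR⟩ := hs.subset_closedBall 0
  refine (hierBall_finite N ⌈R⌉₊).subset fun x hx => ?_
  have h : (hierNorm (x - 0) : ℝ) ≤ R := hR hx
  rw [sub_zero] at h
  have h' : (hierNorm x : ℝ) ≤ (⌈R⌉₊ : ℝ) := h.trans (Nat.le_ceil R)
  exact_mod_cast h'

variable {N : ℕ} (hN : 2 ≤ N) {μ : ℝ} (hμ : 0 < μ) (β : ℝ)

theorem hasSum_powWalk_zero {t : ℝ} (ht : 0 ≤ t) :
    HasSum (fun k => Real.exp (-(powRate hN hμ β k * t)) * haarFun N k 0)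
      (powWalk hN hμ β t 0).toReal := by
  have : NeZero N := ⟨by omega⟩
  exact hasSum_walkPMF hN _ ht 0

/-- Tonelli applies because the Haar functions are nonnegative at `0`. The identity also covers
infinite values, so it settles divergence as well. -/
theorem lintegral_powWalk_zero {ζ : ℝ} (hζ : 0 < ζ) :
    ∫⁻ t in Set.Ioi (0 : ℝ), ENNReal.ofReal (t ^ (ζ - 1)) * powWalk hN hμ β t 0 =
      ∑' k, ENNReal.ofReal (potCoeff hN hμ β ζ k * Real.Gamma ζ) := by
  have : NeZero N := ⟨by omega⟩
  have h1 : ∀ t ∈ Set.Ioi (0 : ℝ), ENNReal.ofReal (t ^ (ζ - 1)) * powWalk hN hμ β t 0 =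
      ∑' k, ENNReal.ofReal (haarFun N k 0) * (ENNReal.ofReal (t ^ (ζ - 1)) *
        ENNReal.ofReal (Real.exp (-(powRate hN hμ β k * t)))) := by
    intro t ht
    have h := hasSum_powWalk_zero hN hμ β (le_of_lt ht)
    rw [← ENNReal.ofReal_toReal (PMF.apply_ne_top (powWalk hN hμ β t) 0), ← h.tsum_eq,
      ENNReal.ofReal_tsum_of_nonneg
        (fun k => mul_nonneg (Real.exp_pos _).le (haarFun_zero_nonneg k)) h.summable,
      ← ENNReal.tsum_mul_left]
    refine tsum_congr fun k => ?_
    rw [ENNReal.ofReal_mul (Real.exp_pos _).le]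
    ring
  rw [setLIntegral_congr_fun measurableSet_Ioi h1, lintegral_tsum fun k => by fun_prop]
  refine tsum_congr fun k => ?_
  rw [lintegral_const_mul _ (by fun_prop), lintegral_rpow_mul_exp hζ (powRate_pos hN hμ β k),
    ← ENNReal.ofReal_mul (haarFun_zero_nonneg k), potCoeff, mul_assoc]

theorem lintegral_powWalk_zero_ne_top_iff {ζ : ℝ} (hζ : 0 < ζ) :
    ∫⁻ t in Set.Ioi (0 : ℝ), ENNReal.ofReal (t ^ (ζ - 1)) * powWalk hN hμ β t 0 ≠ ∞ ↔
      Summable (potCoeff hN hμ β ζ) := by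
  have hG := Real.Gamma_pos_of_pos hζ
  rw [lintegral_powWalk_zero hN hμ β hζ,
    tsum_ofReal_ne_top_iff fun k => mul_nonneg (potCoeff_nonneg hN hμ β ζ k) hG.le,
    summable_mul_right_iff hG.ne']

theorem greenPowerFinite_powWalk {ζ : ℝ} (hζ : 0 < ζ) (hs : Summable (potCoeff hN hμ β ζ)) :
    GreenPowerFinite (powWalk hN hμ β) ζ := by
  have : NeZero N := ⟨by omega⟩
  rintro φ ⟨-, hφ⟩ x
  have hfin := finite_of_isBounded_hierarchicalGroup hφ
  have hφs : ∑' y, (φ (x + y) : ℝ≥0∞) ≠ ∞ := by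
    have he : ∑' y, (φ (x + y) : ℝ≥0∞) = ∑' y, (φ y : ℝ≥0∞) :=
      (Equiv.addLeft x).tsum_eq fun y => (φ y : ℝ≥0∞)
    rw [he, tsum_eq_sum (s := hfin.toFinset) fun y hy => by simpa using hy]
    exact ENNReal.sum_ne_top.2 fun y _ => ENNReal.coe_ne_top
  have hI := (lintegral_powWalk_zero_ne_top_iff hN hμ β hζ).2 hs
  refine ENNReal.div_lt_top ?_ (by simpa using Real.Gamma_pos_of_pos hζ)
  refine ne_top_of_le_ne_top (ENNReal.mul_ne_top hI hφs) ?_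
  rw [← lintegral_mul_const' _ _ hφs]
  refine setLIntegral_mono' measurableSet_Ioi fun t ht => ?_
  rw [mul_assoc]
  gcongr
  rw [transitionSemigroup, ← ENNReal.tsum_mul_left]
  refine ENNReal.tsum_le_tsum fun y => ?_
  gcongr
  exact walkPMF_le_zero hN _ (le_of_lt ht) y

theorem lintegral_powWalk_eq_top {ζ : ℝ} (hζ : 0 < ζ) (hs : ¬ Summable (potCoeff hN hμ β ζ))
    (y : HierarchicalGroup N) :
    ∫⁻ t in Set.Ioi (0 : ℝ), ENNReal.ofReal (t ^ (ζ - 1)) * powWalk hN hμ β t y = ∞ := by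
  have : NeZero N := ⟨by omega⟩
  by_contra hy
  refine hs ((lintegral_powWalk_zero_ne_top_iff hN hμ β hζ).1 ?_)
  have h1 : ∀ t ∈ Set.Ioi (0 : ℝ), ENNReal.ofReal (t ^ (ζ - 1)) * powWalk hN hμ β t 0 ≤
      ENNReal.ofReal (t ^ (ζ - 1)) * powWalk hN hμ β t y + ∑ k ∈ Finset.range (hierNorm y),
        ENNReal.ofReal 2 * (ENNReal.ofReal (t ^ (ζ - 1)) *
          ENNReal.ofReal (Real.exp (-(powRate hN hμ β k * t)))) := by
    intro t ht
    have h : powWalk hN hμ β t 0 ≤ powWalk hN hμ β t y + ∑ k ∈ Finset.range (hierNorm y),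
        ENNReal.ofReal (2 * Real.exp (-(powRate hN hμ β k * t))) :=
      walkPMF_zero_le hN _ (le_of_lt ht) y
    refine (mul_le_mul_right h _).trans_eq ?_
    rw [mul_add, Finset.mul_sum]
    congr 1
    refine Finset.sum_congr rfl fun k _ => ?_
    rw [ENNReal.ofReal_mul zero_le_two]
    ring
  refine ne_top_of_le_ne_top ?_ (setLIntegral_mono' measurableSet_Ioi h1)
  rw [lintegral_add_right _ (by fun_prop)]
  refine ENNReal.add_ne_top.2 ⟨hy, ?_⟩
  rw [lintegral_finsetSum _ fun k _ => by fun_prop]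
  refine ENNReal.sum_ne_top.2 fun k _ => ?_
  rw [lintegral_const_mul _ (by fun_prop), lintegral_rpow_mul_exp hζ (powRate_pos hN hμ β k)]
  exact ENNReal.mul_ne_top ENNReal.ofReal_ne_top ENNReal.ofReal_ne_top

theorem greenPower_powWalk_eq_top {ζ : ℝ} (hζ : 0 < ζ) (hs : ¬ Summable (potCoeff hN hμ β ζ))
    {φ : HierarchicalGroup N → ℝ≥0} (hφ : φ ≠ 0) (x : HierarchicalGroup N) :
    greenPower (powWalk hN hμ β) ζ φ x = ∞ := by
  obtain ⟨z, hz⟩ := Function.ne_iff.1 hφ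
  rw [greenPower, ENNReal.div_eq_top]
  refine Or.inr ⟨?_, ENNReal.ofReal_ne_top⟩
  rw [eq_top_iff]
  have h : ∫⁻ t in Set.Ioi (0 : ℝ), ENNReal.ofReal (t ^ (ζ - 1)) * powWalk hN hμ β t (z - x) *
      (φ z : ℝ≥0∞) = ∞ := by
    rw [lintegral_mul_const' _ _ ENNReal.coe_ne_top, lintegral_powWalk_eq_top hN hμ β hζ hs]
    exact ENNReal.top_mul (by simpa using hz)
  rw [← h]
  refine lintegral_mono fun t => ?_
  rw [mul_assoc]
  gcongr
  refine le_trans ?_ (ENNReal.le_tsum (z - x))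
  rw [add_sub_cancel]

theorem exists_mem_bddSupp_ne_zero (S : Type*) [PseudoMetricSpace S] [Nonempty S] :
    ∃ φ ∈ BddSupp S, φ ≠ 0 := by
  classical
  obtain ⟨a⟩ := ‹Nonempty S›
  refine ⟨Pi.single a 1, ⟨⟨1, fun x => ?_⟩, ?_⟩, by simp⟩
  · rw [Pi.single_apply]
    split_ifs <;> simp
  · exact Bornology.isBounded_singleton.subset Pi.support_single_subset

theorem greenPowerFinite_powWalk_iff {ζ : ℝ} (hζ : 0 < ζ) :
    GreenPowerFinite (powWalk hN hμ β) ζ ↔ Summable (potCoeff hN hμ β ζ) := by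
  refine ⟨fun h => ?_, greenPowerFinite_powWalk hN hμ β hζ⟩
  by_contra hs
  obtain ⟨φ, hφ, h0⟩ := exists_mem_bddSupp_ne_zero (HierarchicalGroup N)
  exact (h φ hφ 0).ne (greenPower_powWalk_eq_top hN hμ β hζ hs h0 0)

theorem degree_powWalk (hβ : 0 < β) : degree (powWalk hN hμ β) = ((μ - 1 : ℝ) : EReal) := by
  refine le_antisymm (sSup_le ?_) (le_of_forall_lt fun c hc => ?_)
  · rintro _ ⟨ζ, hζ, hf, rfl⟩
    rw [greenPowerFinite_powWalk_iff hN hμ β (by linarith)] at hf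
    rw [EReal.coe_le_coe_iff]
    by_contra! hlt
    exact not_summable_potCoeff_of_gt hN hμ β hβ (by linarith) hf
  -- The maximum with `-1` keeps the intermediate `ζ` admissible, with `ζ + 1 > 0`.
  · have hc' : max c ((-1 : ℝ) : EReal) < ((μ - 1 : ℝ) : EReal) :=
      max_lt hc (EReal.coe_lt_coe_iff.2 (by linarith))
    obtain ⟨ζ, h1, h2⟩ := EReal.lt_iff_exists_real_btwn.1 hc'
    rw [max_lt_iff, EReal.coe_lt_coe_iff] at h1
    rw [EReal.coe_lt_coe_iff] at h2
    refine h1.1.trans_le (le_sSup ⟨ζ, h1.2, ?_, rfl⟩)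
    exact greenPowerFinite_powWalk hN hμ β (by linarith)
      (summable_potCoeff_of_lt hN hμ β hβ (by linarith))

theorem hasDegreeMinus_powWalk_iff (hβ : 0 < β) :
    HasDegreeMinus (powWalk hN hμ β) (μ - 1) ↔ β ≤ 1 / μ := by
  rw [← not_lt, ← summable_potCoeff_self_iff hN hμ β hβ, HasDegreeMinus, sub_add_cancel]
  refine ⟨fun h hs => ?_, fun hs => ⟨degree_powWalk hN hμ β hβ, fun φ _ h0 x =>
    greenPower_powWalk_eq_top hN hμ β hμ hs h0 x⟩⟩
  obtain ⟨φ, hφ, h0⟩ := exists_mem_bddSupp_ne_zero (HierarchicalGroup N)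
  exact (greenPowerFinite_powWalk hN hμ β hμ hs φ hφ 0).ne (h.2 φ hφ h0 0)

end Green

/-! ### Incomplete Gamma integrals -/

section LowerGamma

/-- The lower incomplete Gamma function. -/
def lowerGamma (μ x : ℝ) : ℝ :=
  ∫ s in (0 : ℝ)..x, s ^ (μ - 1) * Real.exp (-s)

variable {μ : ℝ}

theorem integrableOn_rpow_mul_exp_neg (hμ : 0 < μ) :
    IntegrableOn (fun s : ℝ => s ^ (μ - 1) * Real.exp (-s)) (Set.Ioi 0) := by
  simpa using integrableOn_rpow_mul_exp hμ one_pos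

theorem integral_rpow_mul_exp_neg (hμ : 0 < μ) :
    ∫ s in Set.Ioi (0 : ℝ), s ^ (μ - 1) * Real.exp (-s) = Real.Gamma μ := by
  simpa using Real.integral_rpow_mul_exp_neg_mul_Ioi hμ one_pos

theorem lowerGamma_mono (hμ : 0 < μ) {x y : ℝ} (hx : 0 ≤ x) (hxy : x ≤ y) :
    lowerGamma μ x ≤ lowerGamma μ y := by
  rw [lowerGamma, lowerGamma, intervalIntegral.integral_of_le hx,
    intervalIntegral.integral_of_le (hx.trans hxy)]
  refine setIntegral_mono_set
    ((integrableOn_rpow_mul_exp_neg hμ).mono_set Set.Ioc_subset_Ioi_self) ?_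
    (Set.Ioc_subset_Ioc_right hxy).eventuallyLE
  refine (ae_restrict_mem measurableSet_Ioc).mono fun s hs => ?_
  exact mul_nonneg (Real.rpow_nonneg hs.1.le _) (Real.exp_pos _).le

theorem lowerGamma_nonneg (hμ : 0 < μ) {x : ℝ} (hx : 0 ≤ x) : 0 ≤ lowerGamma μ x := by
  simpa [lowerGamma] using lowerGamma_mono hμ le_rfl hx

theorem tendsto_lowerGamma (hμ : 0 < μ) :
    Tendsto (lowerGamma μ) atTop (nhds (Real.Gamma μ)) := by
  rw [← integral_rpow_mul_exp_neg hμ]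
  exact intervalIntegral_tendsto_integral_Ioi 0 (integrableOn_rpow_mul_exp_neg hμ) tendsto_id

theorem lowerGamma_le_Gamma (hμ : 0 < μ) {x : ℝ} (hx : 0 ≤ x) :
    lowerGamma μ x ≤ Real.Gamma μ :=
  ge_of_tendsto (tendsto_lowerGamma hμ)
    ((eventually_ge_atTop x).mono fun _ hy => lowerGamma_mono hμ hx hy)

theorem integral_rpow_mul_exp_eq_lowerGamma {h t : ℝ} (hh : 0 < h) (ht : 0 ≤ t) :
    ∫ s in (0 : ℝ)..t, s ^ (μ - 1) * Real.exp (-(h * s)) = h ^ (-μ) * lowerGamma μ (h * t) := by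
  have h1 := intervalIntegral.integral_comp_mul_left
    (fun s : ℝ => s ^ (μ - 1) * Real.exp (-s)) hh.ne' (a := 0) (b := t)
  rw [mul_zero, smul_eq_mul] at h1
  have h2 : ∫ s in (0 : ℝ)..t, (h * s) ^ (μ - 1) * Real.exp (-(h * s)) =
      h ^ (μ - 1) * ∫ s in (0 : ℝ)..t, s ^ (μ - 1) * Real.exp (-(h * s)) := by
    rw [← intervalIntegral.integral_const_mul]
    refine intervalIntegral.integral_congr fun s hs => ?_
    rw [Set.uIcc_of_le ht] at hs
    simp only [Real.mul_rpow hh.le hs.1, mul_assoc]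
  rw [h2, Real.rpow_sub_one hh.ne'] at h1
  have h3 := Real.rpow_pos_of_pos hh μ
  rw [lowerGamma, Real.rpow_neg hh.le]
  field_simp at h1 ⊢
  linarith

/-- Dropping the exponential loses little when `h t` is small, as on the levels not yet explored. -/
theorem integral_rpow_mul_exp_le (hμ : 0 < μ) {h t : ℝ} (hh : 0 ≤ h) (ht : 0 ≤ t) :
    ∫ s in (0 : ℝ)..t, s ^ (μ - 1) * Real.exp (-(h * s)) ≤ t ^ μ / μ := by
  have hi : IntervalIntegrable (fun s : ℝ => s ^ (μ - 1)) volume 0 t :=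
    intervalIntegral.intervalIntegrable_rpow' (by linarith)
  have h1 : ∫ s in (0 : ℝ)..t, s ^ (μ - 1) = t ^ μ / μ := by
    rw [integral_rpow (Or.inl (by linarith)), sub_add_cancel, Real.zero_rpow hμ.ne', sub_zero]
  rw [← h1]
  refine intervalIntegral.integral_mono_on ht (hi.mul_continuousOn (by fun_prop)) hi fun s hs => ?_
  refine mul_le_of_le_one_right (Real.rpow_nonneg hs.1 _) ?_
  rw [Real.exp_le_one_iff]
  have := mul_nonneg hh hs.1
  linarith

end LowerGamma

/-! ### The incomplete potential -/

section Potential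

/-- The number of levels of the hierarchy which the walk has explored at time `t`. -/
def exploredLevel (N : ℕ) (μ t : ℝ) : ℕ :=
  ⌊μ / Real.log N * Real.log t⌋₊

theorem rpow_le_of_lt_exploredLevel {N : ℕ} (hN : 2 ≤ N) {μ : ℝ} (hμ : 0 < μ) {t : ℝ} (ht : 1 ≤ t)
    {k : ℕ} (hk : k < exploredLevel N μ t) :
    (N : ℝ) ^ ((k : ℝ) / μ) ≤ t := by
  have hN1 : (1 : ℝ) < N := by exact_mod_cast (by omega : 1 < N)
  have hl := Real.log_pos hN1
  have h0 : 0 ≤ μ / Real.log N * Real.log t :=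
    mul_nonneg (div_nonneg hμ.le hl.le) (Real.log_nonneg ht)
  have h1 : (k : ℝ) ≤ μ / Real.log N * Real.log t :=
    le_trans (by exact_mod_cast hk.le) (Nat.floor_le h0)
  rw [← Real.log_le_log_iff (by positivity) (by linarith), Real.log_rpow (by linarith),
    div_mul_eq_mul_div, div_le_iff₀ hμ]
  rw [div_mul_eq_mul_div, le_div_iff₀ hl] at h1
  linarith

/-- Taking the floor loses less than one level, hence at most a factor `N`. -/
theorem inv_pow_exploredLevel_mul_le {N : ℕ} (hN : 2 ≤ N) {μ t : ℝ} (ht : 1 ≤ t) :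
    ((N : ℝ) ^ exploredLevel N μ t)⁻¹ * t ^ μ ≤ N := by
  have hN1 : (1 : ℝ) < N := by exact_mod_cast (by omega : 1 < N)
  have hl := Real.log_pos hN1
  have h1 : μ / Real.log N * Real.log t ≤ exploredLevel N μ t + 1 := (Nat.lt_floor_add_one _).le
  rw [inv_mul_le_iff₀ (by positivity), ← pow_succ,
    ← Real.log_le_log_iff (Real.rpow_pos_of_pos (by linarith) _) (by positivity),
    Real.log_rpow (by linarith), Real.log_pow]
  rw [div_mul_eq_mul_div, div_le_iff₀ hl] at h1
  push_cast
  exact h1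

theorem hasSum_haarFun_zero_add {N : ℕ} (hN : 2 ≤ N) (J : ℕ) :
    HasSum (fun k => haarFun N (k + J) 0) ((N : ℝ) ^ J)⁻¹ := by
  have hN1 : (1 : ℝ) < N := by exact_mod_cast (by omega : 1 < N)
  have : NeZero N := ⟨by omega⟩
  rw [hasSum_iff_tendsto_nat_of_nonneg fun k => haarFun_zero_nonneg _]
  have h1 : Tendsto (fun K : ℕ => ((N : ℝ) ^ (K + J))⁻¹) atTop (nhds 0) :=
    ((tendsto_pow_atTop_atTop_of_one_lt hN1).comp (tendsto_add_atTop_nat J)).inv_tendsto_atTop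
  have h2 := h1.const_sub ((N : ℝ) ^ J)⁻¹
  rw [sub_zero] at h2
  refine h2.congr fun n => ?_
  have h3 := Finset.sum_range_sub' (fun k => ((N : ℝ) ^ (k + J))⁻¹) n
  rw [zero_add] at h3
  rw [← h3]
  refine Finset.sum_congr rfl fun k _ => ?_
  rw [haarFun_zero, add_right_comm]

variable {N : ℕ} (hN : 2 ≤ N) {μ : ℝ} (hμ : 0 < μ) (β : ℝ)

theorem hasSum_incompletePotential {t : ℝ} (ht : 0 ≤ t) :
    HasSum (fun k => 1 / Real.Gamma μ * (haarFun N k 0 *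
      ∫ s in (0 : ℝ)..t, s ^ (μ - 1) * Real.exp (-(powRate hN hμ β k * s))))
      (incompletePotential (powWalk hN hμ β) μ t) := by
  have : NeZero N := ⟨by omega⟩
  rw [incompletePotential]
  refine HasSum.mul_left _ ?_
  set F : ℕ → ℝ → ℝ := fun k s =>
    haarFun N k 0 * (s ^ (μ - 1) * Real.exp (-(powRate hN hμ β k * s))) with hF
  have hint : ∀ k, ∫ s in Set.Ioc 0 t, F k s = haarFun N k 0 *
      ∫ s in (0 : ℝ)..t, s ^ (μ - 1) * Real.exp (-(powRate hN hμ β k * s)) := by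
    intro k
    rw [intervalIntegral.integral_of_le ht, integral_const_mul]
  have hnorm : ∀ k, ∫ s in Set.Ioc 0 t, ‖F k s‖ = ∫ s in Set.Ioc 0 t, F k s := by
    intro k
    refine setIntegral_congr_fun measurableSet_Ioc fun s hs => Real.norm_of_nonneg ?_
    exact mul_nonneg (haarFun_zero_nonneg k)
      (mul_nonneg (Real.rpow_nonneg hs.1.le _) (Real.exp_pos _).le)
  have hsum : Summable fun k => ∫ s in Set.Ioc 0 t, ‖F k s‖ := by
    refine Summable.of_nonneg_of_le (fun k => integral_nonneg fun s => norm_nonneg _) (fun k => ?_)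
      ((summable_inv_pow hN).mul_right (t ^ μ / μ))
    rw [hnorm, hint]
    refine mul_le_mul ((le_abs_self _).trans (abs_haarFun_le k 0))
      (integral_rpow_mul_exp_le hμ (powRate_pos hN hμ β k).le ht) ?_ (by positivity)
    rw [integral_rpow_mul_exp_eq_lowerGamma (powRate_pos hN hμ β k) ht]
    exact mul_nonneg (Real.rpow_nonneg (powRate_pos hN hμ β k).le _)
      (lowerGamma_nonneg hμ (mul_nonneg (powRate_pos hN hμ β k).le ht))
  have h := hasSum_integral_of_summable_integral_norm (μ := volume.restrict (Set.Ioc 0 t))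
    (F := F) (fun k => ((integrableOn_rpow_mul_exp hμ (powRate_pos hN hμ β k)).mono_set
      Set.Ioc_subset_Ioi_self).const_mul _) hsum
  simp only [hint] at h
  convert! h using 1
  rw [intervalIntegral.integral_of_le ht]
  refine setIntegral_congr_fun measurableSet_Ioc fun s hs => ?_
  rw [← (hasSum_powWalk_zero hN hμ β hs.1.le).tsum_eq, ← tsum_mul_left]
  exact tsum_congr fun k => by rw [hF]; ring

theorem hasSum_incompletePotential_lowerGamma {t : ℝ} (ht : 0 ≤ t) :
    HasSum (fun k => potCoeff hN hμ β μ k *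
      (lowerGamma μ (powRate hN hμ β k * t) / Real.Gamma μ))
      (incompletePotential (powWalk hN hμ β) μ t) := by
  convert! hasSum_incompletePotential hN hμ β ht using 2 with k
  rw [integral_rpow_mul_exp_eq_lowerGamma (powRate_pos hN hμ β k) ht, potCoeff]
  ring

/-- Below the cutoff `N^(k/μ) ≤ t`, so `h_k t` is at least a constant times `(k+1)^β`. The resulting
weights do not depend on `t`. -/
theorem le_incompletePotential {t : ℝ} (ht : 1 ≤ t) :
    ∑ k ∈ Finset.range (exploredLevel N μ t), potCoeff hN hμ β μ k *
      (lowerGamma μ (radiusConst N μ β * ((k : ℝ) + 1) ^ β) / Real.Gamma μ) ≤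
      incompletePotential (powWalk hN hμ β) μ t := by
  have hN0 : (0 : ℝ) < N := by exact_mod_cast (by omega : 0 < N)
  have hG := Real.Gamma_pos_of_pos hμ
  have hD := radiusConst_pos hN hμ β
  have ht0 : 0 ≤ t := by linarith
  have hs := hasSum_incompletePotential_lowerGamma hN hμ β ht0
  refine le_trans (Finset.sum_le_sum fun k hk => ?_) (sum_le_hasSum _ (fun k _ => ?_) hs)
  · refine mul_le_mul_of_nonneg_left ?_ (potCoeff_nonneg hN hμ β μ k)
    refine div_le_div_of_nonneg_right (lowerGamma_mono hμ (by positivity) ?_) hG.le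
    have h1 := mul_le_mul_of_nonneg_right (mul_radiusWeight_le_powRate hN hμ β k) ht0
    refine le_trans ?_ h1
    have h2 := rpow_le_of_lt_exploredLevel hN hμ ht (Finset.mem_range.1 hk)
    rw [mul_assoc]
    refine mul_le_mul_of_nonneg_left ?_ hD.le
    rw [radiusWeight, powSeq, div_mul_eq_mul_div, le_div_iff₀ (by positivity)]
    exact mul_le_mul_of_nonneg_left h2 (by positivity)
  · exact mul_nonneg (potCoeff_nonneg hN hμ β μ k) (div_nonneg
      (lowerGamma_nonneg hμ (mul_nonneg (powRate_pos hN hμ β k).le ht0)) hG.le)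

/-- Below the cutoff the weight is at most 1. Above it the exponential is dropped, and the Haar
values telescope to `N^(-J) t^μ / (μ Γ(μ))`, which is bounded in `t`. -/
theorem incompletePotential_le {t : ℝ} (ht : 1 ≤ t) :
    incompletePotential (powWalk hN hμ β) μ t ≤
      ∑ k ∈ Finset.range (exploredLevel N μ t), potCoeff hN hμ β μ k +
        N / (μ * Real.Gamma μ) := by
  have : NeZero N := ⟨by omega⟩
  have hG := Real.Gamma_pos_of_pos hμ
  have ht0 : 0 ≤ t := by linarith
  have hs := hasSum_incompletePotential_lowerGamma hN hμ β ht0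
  rw [← hs.tsum_eq, ← hs.summable.sum_add_tsum_nat_add (exploredLevel N μ t)]
  refine add_le_add (Finset.sum_le_sum fun k _ => ?_) ?_
  · refine mul_le_of_le_one_right (potCoeff_nonneg hN hμ β μ k) ((div_le_one hG).2 ?_)
    exact lowerGamma_le_Gamma hμ (mul_nonneg (powRate_pos hN hμ β k).le ht0)
  · have hb := (hasSum_haarFun_zero_add hN (exploredLevel N μ t)).mul_right
      (t ^ μ / μ / Real.Gamma μ)
    refine (((summable_nat_add_iff _).2 hs.summable).tsum_le_tsum (fun k => ?_)
      hb.summable).trans ?_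
    · rw [potCoeff, mul_assoc, mul_div_assoc',
        ← integral_rpow_mul_exp_eq_lowerGamma (powRate_pos hN hμ β _) ht0]
      exact mul_le_mul_of_nonneg_left (div_le_div_of_nonneg_right
        (integral_rpow_mul_exp_le hμ (powRate_pos hN hμ β _).le ht0) hG.le)
        (haarFun_zero_nonneg _)
    · rw [hb.tsum_eq, div_div, mul_div_assoc']
      exact div_le_div_of_nonneg_right (inv_pow_exploredLevel_mul_le hN ht) (by positivity)

end Potential

/-! ### Asymptotics of the incomplete potential -/

section Asymptotic

/-- Stolz–Cesàro: a little-o relation survives summation when the majorant has divergent partial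
sums. -/
theorem tendsto_sum_div_sum_of_isEquivalent {u a : ℕ → ℝ} {A : ℝ} (ha : ∀ k, 0 < a k)
    (h : u ~[atTop] fun k => A * a k)
    (hS : Tendsto (fun n => ∑ k ∈ Finset.range n, a k) atTop atTop) :
    Tendsto (fun n => (∑ k ∈ Finset.range n, u k) / ∑ k ∈ Finset.range n, a k) atTop
      (nhds A) := by
  have h1 : (fun k => u k - A * a k) =o[atTop] a :=
    h.isLittleO.trans_isBigO (isBigO_const_mul_self A a atTop)
  have h2 := (h1.sum_range (fun k => (ha k).le) hS).tendsto_div_nhds_zero.add_const A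
  rw [zero_add] at h2
  refine h2.congr' ?_
  filter_upwards [hS.eventually_gt_atTop 0] with n hn
  rw [Finset.sum_sub_distrib, ← Finset.mul_sum]
  field_simp
  ring

theorem tendsto_sum_rpow_neg {s : ℝ} (hs : s ≤ 1) :
    Tendsto (fun n => ∑ k ∈ Finset.range n, ((k : ℝ) + 1) ^ (-s)) atTop atTop := by
  rw [← not_summable_iff_tendsto_nat_atTop_of_nonneg fun k => by positivity]
  intro h
  refine hs.not_gt ((Real.summable_one_div_nat_add_rpow 1 s).1 (h.congr fun k => ?_))
  have hk : (0 : ℝ) < (k : ℝ) + 1 := by positivity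
  rw [abs_of_pos hk, Real.rpow_neg hk.le, one_div]

theorem sum_inv_isEquivalent_log :
    (fun n : ℕ => ∑ k ∈ Finset.range n, ((k : ℝ) + 1) ^ (-1 : ℝ)) ~[atTop]
      fun n => Real.log n := by
  have h : (fun n : ℕ => (harmonic n : ℝ) - Real.log n) =o[atTop] fun n : ℕ => Real.log n :=
    (Real.tendsto_harmonic_sub_log.isBigO_one ℝ).trans_isLittleO
      (isLittleO_const_left.2 (Or.inr (tendsto_norm_atTop_atTop.comp
        (Real.tendsto_log_atTop.comp tendsto_natCast_atTop_atTop))))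
  refine IsEquivalent.congr_left h.isEquivalent (Eventually.of_forall fun n => ?_)
  simp [harmonic, Real.rpow_neg_one]

/-- The increments of `x^(1-s)` at the integers are asymptotic to `(1-s) (k+1)^(-s)`, by
differentiating at 1 along steps `1/(k+1)`, and their sum telescopes. -/
theorem sum_rpow_neg_isEquivalent {s : ℝ} (hs : s < 1) :
    (fun n : ℕ => ∑ k ∈ Finset.range n, ((k : ℝ) + 1) ^ (-s)) ~[atTop]
      fun n => (1 / (1 - s)) * (n : ℝ) ^ (1 - s) := by
  have hs' : 0 < 1 - s := by linarith
  have hd : HasDerivAt (fun x : ℝ => x ^ (1 - s)) (1 - s) 1 := by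
    simpa using Real.hasDerivAt_rpow_const (x := 1) (p := 1 - s) (Or.inl one_ne_zero)
  have ht : Tendsto (fun k : ℕ => ((k : ℝ) + 1)⁻¹) atTop (nhdsWithin 0 {0}ᶜ) := by
    refine tendsto_nhdsWithin_iff.2 ⟨?_, Eventually.of_forall fun k => ?_⟩
    · exact (tendsto_atTop_add_const_right _ _ tendsto_natCast_atTop_atTop).inv_tendsto_atTop
    · have hk : (0 : ℝ) < (k : ℝ) + 1 := by positivity
      simpa using hk.ne'
  have hslope := (hasDerivAt_iff_tendsto_slope_zero.1 hd).comp ht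
  have hu : (fun k : ℕ => ((k : ℝ) + 1 + 1) ^ (1 - s) - ((k : ℝ) + 1) ^ (1 - s)) ~[atTop]
      fun k : ℕ => (1 - s) * ((k : ℝ) + 1) ^ (-s) := by
    refine isEquivalent_of_tendsto_one ?_
    have h2 := hslope.div_const (1 - s)
    rw [div_self hs'.ne'] at h2
    refine h2.congr fun k => ?_
    have hk : (0 : ℝ) < (k : ℝ) + 1 := by positivity
    have e1 : (1 : ℝ) + ((k : ℝ) + 1)⁻¹ = ((k : ℝ) + 1 + 1) / ((k : ℝ) + 1) := by
      field_simp
    have e2 : ((k : ℝ) + 1) ^ (1 - s) = ((k : ℝ) + 1) * ((k : ℝ) + 1) ^ (-s) := by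
      rw [sub_eq_add_neg, Real.rpow_add hk, Real.rpow_one]
    have := Real.rpow_pos_of_pos hk (-s)
    simp only [Function.comp, smul_eq_mul, inv_inv, Real.one_rpow, Pi.div_apply]
    rw [e1, Real.div_rpow (by positivity) hk.le, e2]
    field_simp
  have h1 := tendsto_sum_div_sum_of_isEquivalent (fun k => by positivity) hu
    (tendsto_sum_rpow_neg hs.le)
  have hn : (fun n : ℕ => (n : ℝ) + 1) ~[atTop] fun n : ℕ => (n : ℝ) :=
    IsEquivalent.refl.add_isLittleO (isLittleO_const_left.2
      (Or.inr (tendsto_norm_atTop_atTop.comp tendsto_natCast_atTop_atTop)))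
  have hp : Tendsto (fun n : ℕ => (n : ℝ) ^ (1 - s)) atTop atTop :=
    (tendsto_rpow_atTop hs').comp tendsto_natCast_atTop_atTop
  have h2 : (fun n : ℕ => ((n : ℝ) + 1) ^ (1 - s) - 1) ~[atTop] fun n : ℕ => (n : ℝ) ^ (1 - s) :=
    (hn.rpow (r := 1 - s) fun n => Nat.cast_nonneg n).sub_isLittleO
      (isLittleO_const_left.2 (Or.inr (tendsto_norm_atTop_atTop.comp hp)))
  have h3 : (fun n : ℕ => ((n : ℝ) + 1) ^ (1 - s) - 1) ~[atTop]
      fun n : ℕ => (1 - s) * ∑ k ∈ Finset.range n, ((k : ℝ) + 1) ^ (-s) := by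
    refine isEquivalent_of_tendsto_one ?_
    have h4 := h1.div_const (1 - s)
    rw [div_self hs'.ne'] at h4
    refine h4.congr fun n => ?_
    have h5 := Finset.sum_range_sub (fun k : ℕ => ((k : ℝ) + 1) ^ (1 - s)) n
    push_cast at h5
    rw [h5, Pi.div_apply, div_div, mul_comm (1 - s)]
    simp
  refine ((IsEquivalent.refl (u := fun _ : ℕ => 1 / (1 - s))).mul
    (h3.symm.trans h2)).congr_left (Eventually.of_forall fun n => ?_)
  simp only [Pi.mul_apply]
  field_simp

theorem exploredLevel_isEquivalent {N : ℕ} (hN : 2 ≤ N) {μ : ℝ} (hμ : 0 < μ) :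
    (fun t : ℝ => (exploredLevel N μ t : ℝ)) ~[atTop]
      fun t => μ / Real.log N * Real.log t := by
  have hN1 : (1 : ℝ) < N := by exact_mod_cast (by omega : 1 < N)
  exact isEquivalent_nat_floor.comp_tendsto
    (Real.tendsto_log_atTop.const_mul_atTop (div_pos hμ (Real.log_pos hN1)))

theorem tendsto_exploredLevel {N : ℕ} (hN : 2 ≤ N) {μ : ℝ} (hμ : 0 < μ) :
    Tendsto (exploredLevel N μ) atTop atTop := by
  have hN1 : (1 : ℝ) < N := by exact_mod_cast (by omega : 1 < N)
  exact tendsto_nat_floor_atTop.comp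
    (Real.tendsto_log_atTop.const_mul_atTop (div_pos hμ (Real.log_pos hN1)))

variable {N : ℕ} (hN : 2 ≤ N) {μ : ℝ} (hμ : 0 < μ) {β : ℝ}

theorem incompletePotential_isEquivalent_sum (hβ : 0 < β) (h : β * μ ≤ 1) : ∃ A : ℝ, 0 < A ∧
    (fun t : ℝ => incompletePotential (powWalk hN hμ β) μ t) ~[atTop]
      fun t => A * ∑ k ∈ Finset.range (exploredLevel N μ t), ((k : ℝ) + 1) ^ (-(β * μ)) := by
  have hG := Real.Gamma_pos_of_pos hμ
  have hD := radiusConst_pos hN hμ β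
  obtain ⟨A, hA, hv⟩ := potCoeff_isEquivalent hN hμ β hβ μ
  simp only [div_self hμ.ne', sub_self, mul_zero, Real.rpow_zero, mul_one] at hv
  have hS := tendsto_sum_rpow_neg h
  have hJ := tendsto_exploredLevel hN hμ
  have hg : Tendsto (fun k : ℕ =>
      lowerGamma μ (radiusConst N μ β * ((k : ℝ) + 1) ^ β) / Real.Gamma μ) atTop (nhds 1) := by
    rw [← div_self hG.ne']
    refine ((tendsto_lowerGamma hμ).comp (Tendsto.const_mul_atTop hD ?_)).div_const _
    exact (tendsto_rpow_atTop hβ).comp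
      (tendsto_atTop_add_const_right _ _ tendsto_natCast_atTop_atTop)
  have hl : (fun k : ℕ => potCoeff hN hμ β μ k *
      (lowerGamma μ (radiusConst N μ β * ((k : ℝ) + 1) ^ β) / Real.Gamma μ)) ~[atTop]
      fun k : ℕ => A * ((k : ℝ) + 1) ^ (-(β * μ)) := by
    have h1 := hv.mul ((isEquivalent_const_iff_tendsto one_ne_zero).2 hg)
    simpa only [Pi.mul_def, Function.const_apply, mul_one] using h1
  have ha : ∀ k : ℕ, 0 < ((k : ℝ) + 1) ^ (-(β * μ)) := fun k => by positivity
  -- Both bounds have the same limit `A`: the lower weights tend to 1 because `β > 0`, and the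
  -- additive constant above is negligible against sums that diverge for `βμ ≤ 1`.
  have hlow := (tendsto_sum_div_sum_of_isEquivalent ha hl hS).comp hJ
  have hup := ((tendsto_sum_div_sum_of_isEquivalent ha hv hS).comp hJ).add
    (Tendsto.div_atTop (tendsto_const_nhds (x := N / (μ * Real.Gamma μ))) (hS.comp hJ))
  rw [add_zero] at hup
  refine ⟨A, hA, isEquivalent_of_tendsto_one ?_⟩
  have hpos := (hS.comp hJ).eventually_gt_atTop 0
  have hmain : Tendsto (fun t => incompletePotential (powWalk hN hμ β) μ t /
      ∑ k ∈ Finset.range (exploredLevel N μ t), ((k : ℝ) + 1) ^ (-(β * μ))) atTop (nhds A) := by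
    refine tendsto_of_tendsto_of_tendsto_of_le_of_le' hlow hup ?_ ?_
    · filter_upwards [hpos, eventually_ge_atTop 1] with t h0 ht
      exact div_le_div_of_nonneg_right (le_incompletePotential hN hμ β ht) h0.le
    · filter_upwards [hpos, eventually_ge_atTop 1] with t h0 ht
      simp only [Function.comp_apply]
      rw [← add_div]
      exact div_le_div_of_nonneg_right (incompletePotential_le hN hμ β ht) h0.le
  have h2 := hmain.div_const A
  rw [div_self hA.ne'] at h2
  refine h2.congr fun t => ?_
  rw [Pi.div_apply, div_div, mul_comm A]

theorem incompletePotential_isEquivalent_log_log (hβ : 0 < β) (h : β * μ = 1) :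
    ∃ C : ℝ, 0 < C ∧ (fun t : ℝ => incompletePotential (powWalk hN hμ β) μ t) ~[atTop]
      fun t => C * Real.log (Real.log t) := by
  have hN1 : (1 : ℝ) < N := by exact_mod_cast (by omega : 1 < N)
  have hκ : 0 < μ / Real.log N := div_pos hμ (Real.log_pos hN1)
  obtain ⟨A, hA, hg⟩ := incompletePotential_isEquivalent_sum hN hμ hβ h.le
  refine ⟨A, hA, hg.trans (IsEquivalent.mul IsEquivalent.refl ?_)⟩
  rw [h]
  refine (sum_inv_isEquivalent_log.comp_tendsto (tendsto_exploredLevel hN hμ)).trans ?_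
  refine ((exploredLevel_isEquivalent hN hμ).log
    (Real.tendsto_log_atTop.const_mul_atTop hκ)).trans ?_
  have hll : Tendsto (fun t : ℝ => Real.log (Real.log t)) atTop atTop :=
    Real.tendsto_log_atTop.comp Real.tendsto_log_atTop
  -- Inside the double logarithm the factor `μ / log N` only adds a constant, so it does not affect
  -- `C`.
  have h1 : (fun _ : ℝ => Real.log (μ / Real.log N)) =o[atTop]
      fun t : ℝ => Real.log (Real.log t) :=
    isLittleO_const_left.2 (Or.inr (tendsto_norm_atTop_atTop.comp hll))
  refine IsEquivalent.congr_left (h1.add_isEquivalent IsEquivalent.refl) ?_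
  filter_upwards [Real.tendsto_log_atTop.eventually_gt_atTop 0] with t ht
  simp [Real.log_mul hκ.ne' ht.ne']

theorem incompletePotential_isEquivalent_log_rpow (hβ : 0 < β) (h : β * μ < 1) :
    ∃ C : ℝ, 0 < C ∧ (fun t : ℝ => incompletePotential (powWalk hN hμ β) μ t) ~[atTop]
      fun t => C * Real.log t ^ (1 - β * μ) := by
  have hN1 : (1 : ℝ) < N := by exact_mod_cast (by omega : 1 < N)
  have hκ : 0 < μ / Real.log N := div_pos hμ (Real.log_pos hN1)
  have hs : 0 < 1 - β * μ := by linarith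
  obtain ⟨A, hA, hg⟩ := incompletePotential_isEquivalent_sum hN hμ hβ h.le
  have h1 := (sum_rpow_neg_isEquivalent h).comp_tendsto (tendsto_exploredLevel hN hμ)
  -- Truncation at 0 supplies the nonnegativity for all `t` that `IsEquivalent.rpow` requires; `log
  -- t` is negative for `0 < t < 1`.
  let m : ℝ → ℝ := fun t => max 0 (μ / Real.log N * Real.log t)
  have hme : (fun t => μ / Real.log N * Real.log t) =ᶠ[atTop] m := by
    filter_upwards [eventually_ge_atTop 1] with t ht
    exact (max_eq_right (mul_nonneg hκ.le (Real.log_nonneg ht))).symm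
  have h2 : (fun t => (exploredLevel N μ t : ℝ)) ^ (1 - β * μ) ~[atTop] m ^ (1 - β * μ) :=
    IsEquivalent.rpow (fun t => le_max_left 0 _)
      ((exploredLevel_isEquivalent hN hμ).congr_right hme)
  refine ⟨A * (1 / (1 - β * μ) * (μ / Real.log N) ^ (1 - β * μ)),
    by positivity, ?_⟩
  have h3 := hg.trans ((IsEquivalent.refl (u := fun _ : ℝ => A)).mul
    (h1.trans ((IsEquivalent.refl (u := fun _ : ℝ => 1 / (1 - β * μ))).mul h2)))
  refine h3.congr_right ?_
  filter_upwards [hme, eventually_ge_atTop 1] with t h4 ht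
  simp only [Pi.mul_apply, Pi.pow_apply, ← h4]
  rw [Real.mul_rpow hκ.le (Real.log_nonneg ht)]
  ring

end Asymptotic

theorem mainTheorem4 (N : ℕ) (hN : 2 ≤ N) (μ β : ℝ) (hμ : 0 < μ) (hβ : 0 < β) :
    degree (powWalk hN hμ β) = ((μ - 1 : ℝ) : EReal) ∧
    (HasDegreeMinus (powWalk hN hμ β) (μ - 1) ↔ β ≤ 1 / μ) ∧
    (β = 1 / μ → ∃ C : ℝ, 0 < C ∧
      (fun t : ℝ => incompletePotential (powWalk hN hμ β) μ t)
        ~[atTop] fun t : ℝ => C * Real.log (Real.log t)) ∧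
    (β < 1 / μ → ∃ C : ℝ, 0 < C ∧
      (fun t : ℝ => incompletePotential (powWalk hN hμ β) μ t)
        ~[atTop] fun t : ℝ => C * (Real.log t) ^ (1 - β * μ)) :=
  ⟨degree_powWalk hN hμ β hβ, hasDegreeMinus_powWalk_iff hN hμ β hβ,
    fun h => incompletePotential_isEquivalent_log_log hN hμ hβ ((eq_div_iff hμ.ne').1 h),
    fun h => incompletePotential_isEquivalent_log_rpow hN hμ hβ ((lt_div_iff₀ hμ).1 h)⟩

end
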